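/- Setting. Let $V$ be a finite-dimensional real vector space with a symmetric bilinear form $\ell$ of signature $(+,-,\dots,-)$, and let $C$ be one of the two closed convex cones whose union is $\{v:\ell(v,v)\ge 0\}$. A (time-oriented) flat complete Lorentzian manifold is a quotient $M=V/\Gamma$, where $\Gamma$ is a discrete group of affine transformations of $V$, acting freely and properly, whose linear parts preserve $\ell$ and $C$; $M$ carries the Lorentzian metric and the field of cones induced by $\ell$ and $C$. Let $\kappa:V\to M$ be the quotient mapping. The future and the past of $p=\kappa(v)$ are $F_p=\kappa(v+C)$ and $P_p=\kappa(v-C)$. A piecewise smooth path in $M$ is timelike if its velocity always lies in the (closed) cone, and $M$ is causal if it admits no nonconstant closed piecewise smooth timelike path. $M$ is strictly causal if it is causal and each $p\in M$ has a neighbourhood $U$ such that $U\cap F_p$ and $U\cap P_p$ are closed in $U$. $M$ is elliptic if some vector in the interior of $C$ is fixed by the linear parts of all elements of $\Gamma$. Two Lorentzian manifolds $(M_1,\ell_1)$, $(M_2,\ell_2)$ are homothetic if for some $t>0$ there is an isometry (a diffeomorphism preserving the metrics) of $(M_1,t\ell_1)$ onto $(M_2,\ell_2)$. Theorem. Every $4$-dimensional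 strictly causal flat complete Lorentzian manifold that is not elliptic is homothetic to the manifold $\mathbb{R}^4/\Gamma$, where $\mathbb{R}^4$ carries the form with $\ell(v,v)=2v_0v_3-v_1^2-v_2^2$, $v=(v_0,v_1,v_2,v_3)^\top$, and $\Gamma=\{\gamma_n\}_{n\in\mathbb{Z}}$ is the infinite cyclic group of the affine transformations $$\gamma_n(v)=\begin{pmatrix}1&0&n&\frac{n^2}{2}\\0&1&0&0\\0&0&1&n\\0&0&0&1\end{pmatrix}v+\begin{pmatrix}0\\n\\0\\0\end{pmatrix}.$$ -/

import Mathlib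

open Set Topology
open scoped ContDiff

/-- A Lorentzian form, i.e. a symmetric bilinear form of signature `(+,-,…,-)`: some vector `e`
has `ℓ(e,e) > 0`, and the form is negative definite on the orthogonal complement of `e`. -/
structure IsLorentzianForm {V : Type*} [AddCommGroup V] [Module ℝ V]
    (ℓ : LinearMap.BilinForm ℝ V) : Prop where
  symm : ∀ v w, ℓ v w = ℓ w v
  exists_timelike : ∃ e, 0 < ℓ e e ∧ ∀ w, ℓ e w = 0 → w ≠ 0 → ℓ w w < 0

/-- `C` is one of the two closed convex cones whose union is `{v | ℓ(v,v) ≥ 0}`: the one that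
contains the timelike vector `e`. -/
def IsTimeCone {V : Type*} [AddCommGroup V] [Module ℝ V]
    (ℓ : LinearMap.BilinForm ℝ V) (C : Set V) : Prop :=
  ∃ e, 0 < ℓ e e ∧ C = {v | 0 ≤ ℓ v v ∧ 0 ≤ ℓ e v}

/-- A (time-oriented) flat complete Lorentzian manifold, presented as the quotient `V / Γ` of
Minkowski space `V`: a Lorentzian form on `V`, one of its two cones, and a group `Γ` of affine
transformations of `V` whose linear parts keep the form and the cone, acting freely and properly
(as a discrete group). The norm of `V` serves only for its topology and smooth structure. -/
structure FlatLorentzianManifold (V : Type*) [NormedAddCommGroup V] [NormedSpace ℝ V]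
    [FiniteDimensional ℝ V] where
  form : LinearMap.BilinForm ℝ V
  lorentzian : IsLorentzianForm form
  cone : Set V
  isTimeCone : IsTimeCone form cone
  group : Subgroup (V ≃ᵃ[ℝ] V)
  map_form : ∀ γ ∈ group, ∀ v w, form (γ.linear v) (γ.linear w) = form v w
  map_cone : ∀ γ ∈ group, ∀ v, γ.linear v ∈ cone ↔ v ∈ cone
  free : ∀ γ ∈ group, ∀ v, γ v = v → γ = 1
  proper : ∀ K L : Set V, IsCompact K → IsCompact L →
    {γ : V ≃ᵃ[ℝ] V | γ ∈ group ∧ (γ '' K ∩ L).Nonempty}.Finite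

namespace FlatLorentzianManifold

section Basic

variable {V : Type*} [NormedAddCommGroup V] [NormedSpace ℝ V] [FiniteDimensional ℝ V]

/-- Two points of `V` are equivalent if they lie in one `Γ`-orbit. -/
def orbitSetoid (M : FlatLorentzianManifold V) : Setoid V where
  r v w := ∃ γ ∈ M.group, γ v = w
  iseqv :=
    { refl := fun v => ⟨1, M.group.one_mem, rfl⟩
      symm := by
        rintro v w ⟨γ, hγ, rfl⟩
        exact ⟨γ⁻¹, M.group.inv_mem hγ, γ.symm_apply_apply v⟩
      trans := by
        rintro u v w ⟨γ, hγ, rfl⟩ ⟨δ, hδ, rfl⟩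
        exact ⟨δ * γ, M.group.mul_mem hδ hγ, rfl⟩ }

/-- The underlying space `V / Γ`, with the quotient topology. -/
def Carrier (M : FlatLorentzianManifold V) : Type _ := Quotient M.orbitSetoid

instance (M : FlatLorentzianManifold V) : TopologicalSpace M.Carrier :=
  inferInstanceAs (TopologicalSpace (Quotient M.orbitSetoid))

/-- The quotient mapping `κ : V → V / Γ`. -/
def proj (M : FlatLorentzianManifold V) (v : V) : M.Carrier := Quotient.mk M.orbitSetoid v

/-- The future `F_p = κ(v + C)`, `v ∈ κ⁻¹(p)` (the set `κ(v + C)` does not depend on `v`). -/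
def future (M : FlatLorentzianManifold V) (p : M.Carrier) : Set M.Carrier :=
  {q | ∃ v, M.proj v = p ∧ ∃ c ∈ M.cone, M.proj (v + c) = q}

/-- The past `P_p = κ(v - C)`, `v ∈ κ⁻¹(p)` (the set `κ(v - C)` does not depend on `v`). -/
def past (M : FlatLorentzianManifold V) (p : M.Carrier) : Set M.Carrier :=
  {q | ∃ v, M.proj v = p ∧ ∃ c ∈ M.cone, M.proj (v - c) = q}

/-- `η` is a smooth timelike path in `V / Γ` on the interval `[a, b]`: locally it is the
projection of a smooth path in `V` whose velocity lies in the cone. -/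
def IsSmoothTimelikeOn (M : FlatLorentzianManifold V) (η : ℝ → M.Carrier) (a b : ℝ) : Prop :=
  ∀ t ∈ Icc a b, ∃ J : Set ℝ, IsOpen J ∧ t ∈ J ∧ ∃ c : ℝ → V,
    ContDiffOn ℝ ∞ c (Icc a b ∩ J) ∧
    ∀ s ∈ Icc a b ∩ J, M.proj (c s) = η s ∧ derivWithin c (Icc a b) s ∈ M.cone

/-- `η` is, on `[0, 1]`, a piecewise smooth timelike path. -/
def IsTimelikePath (M : FlatLorentzianManifold V) (η : ℝ → M.Carrier) : Prop :=
  ∃ (n : ℕ) (p : ℕ → ℝ), p 0 = 0 ∧ p n = 1 ∧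
    ∀ i < n, p i < p (i + 1) ∧ M.IsSmoothTimelikeOn η (p i) (p (i + 1))

/-- There is no closed (nonconstant) piecewise smooth timelike path. -/
def IsCausal (M : FlatLorentzianManifold V) : Prop :=
  ¬ ∃ η : ℝ → M.Carrier, M.IsTimelikePath η ∧ η 0 = η 1 ∧ ∃ t ∈ Icc (0 : ℝ) 1, η t ≠ η 0

/-- Causal, and each point `p` has a neighbourhood `U` in which `U ∩ F_p` and `U ∩ P_p` are
(relatively) closed. -/
def IsStrictlyCausal (M : FlatLorentzianManifold V) : Prop :=
  M.IsCausal ∧ ∀ p : M.Carrier, ∃ U ∈ 𝓝 p,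
    IsClosed ((fun x : U => (x : M.Carrier)) ⁻¹' M.future p) ∧
    IsClosed ((fun x : U => (x : M.Carrier)) ⁻¹' M.past p)

/-- The linear holonomy group `G` has a fixed vector in the interior of the cone. -/
def IsElliptic (M : FlatLorentzianManifold V) : Prop :=
  ∃ v ∈ interior M.cone, ∀ γ ∈ M.group, γ.linear v = v

end Basic

section Maps

variable {V₁ V₂ : Type*} [NormedAddCommGroup V₁] [NormedSpace ℝ V₁] [FiniteDimensional ℝ V₁]
  [NormedAddCommGroup V₂] [NormedSpace ℝ V₂] [FiniteDimensional ℝ V₂]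

/-- On the open set `U`, the smooth mapping `g` between the vector spaces represents the mapping
`f` between the quotients. -/
def IsSmoothLift (M₁ : FlatLorentzianManifold V₁) (M₂ : FlatLorentzianManifold V₂)
    (f : M₁.Carrier → M₂.Carrier) (U : Set V₁) (g : V₁ → V₂) : Prop :=
  IsOpen U ∧ ContDiffOn ℝ ∞ g U ∧ ∀ u ∈ U, M₂.proj (g u) = f (M₁.proj u)

/-- Smooth mappings. The quotient mappings are smooth coverings, so these are the mappings that
are locally represented by smooth mappings between the vector spaces. -/
def IsSmoothMap (M₁ : FlatLorentzianManifold V₁) (M₂ : FlatLorentzianManifold V₂)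
    (f : M₁.Carrier → M₂.Carrier) : Prop :=
  ∀ v : V₁, ∃ (U : Set V₁) (g : V₁ → V₂), v ∈ U ∧ IsSmoothLift M₁ M₂ f U g

/-- `f` pulls back the metric of `M₂` to `t` times the metric of `M₁`. -/
def PullsBackMetric (M₁ : FlatLorentzianManifold V₁) (M₂ : FlatLorentzianManifold V₂) (t : ℝ)
    (f : M₁.Carrier → M₂.Carrier) : Prop :=
  ∀ v : V₁, ∃ (U : Set V₁) (g : V₁ → V₂), v ∈ U ∧ IsSmoothLift M₁ M₂ f U g ∧
    ∀ u ∈ U, ∀ x y : V₁, M₂.form (fderiv ℝ g u x) (fderiv ℝ g u y) = t * M₁.form x y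

/-- For some `t > 0` there is an isometry of `(M₁, t ℓ₁)` onto `(M₂, ℓ₂)`, that is, a
diffeomorphism that pulls back `ℓ₂` to `t ℓ₁`. -/
def Homothetic (M₁ : FlatLorentzianManifold V₁) (M₂ : FlatLorentzianManifold V₂) : Prop :=
  ∃ t : ℝ, 0 < t ∧ ∃ f : M₁.Carrier ≃ₜ M₂.Carrier,
    IsSmoothMap M₁ M₂ f ∧ IsSmoothMap M₂ M₁ f.symm ∧ PullsBackMetric M₁ M₂ t f

end Maps

end FlatLorentzianManifold

/-! The manifold `ℝ⁴ / ℤ`. -/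

namespace ParabolicExample

/-- The form with `ℓ(v,v) = 2 v₀ v₃ - v₁² - v₂²`. -/
def form : LinearMap.BilinForm ℝ (Fin 4 → ℝ) :=
  LinearMap.mk₂ ℝ (fun v w => v 0 * w 3 + v 3 * w 0 - v 1 * w 1 - v 2 * w 2)
    (by intros; simp only [Pi.add_apply]; ring)
    (by intros; simp only [Pi.smul_apply, smul_eq_mul]; ring)
    (by intros; simp only [Pi.add_apply]; ring)
    (by intros; simp only [Pi.smul_apply, smul_eq_mul]; ring)

theorem form_apply (v w : Fin 4 → ℝ) :
    form v w = v 0 * w 3 + v 3 * w 0 - v 1 * w 1 - v 2 * w 2 := rfl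

/-- The cone `ℓ(v,v) ≥ 0`, `v₀ + v₃ ≥ 0`. -/
def cone : Set (Fin 4 → ℝ) := {v | 0 ≤ form v v ∧ 0 ≤ v 0 + v 3}

/-- The matrix `λ(n)`. -/
noncomputable def linMatrix (n : ℤ) : Matrix (Fin 4) (Fin 4) ℝ :=
  !![1, 0, (n : ℝ), (n : ℝ) ^ 2 / 2;
     0, 1, 0, 0;
     0, 0, 1, (n : ℝ);
     0, 0, 0, 1]

/-- The vector `τ(n)`. -/
def transVec (n : ℤ) : Fin 4 → ℝ := ![0, (n : ℝ), 0, 0]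

theorem linMatrix_mulVec (n : ℤ) (v : Fin 4 → ℝ) :
    (linMatrix n).mulVec v =
      ![v 0 + n * v 2 + (n : ℝ) ^ 2 / 2 * v 3, v 1, v 2 + n * v 3, v 3] := by
  ext i
  fin_cases i <;> simp [linMatrix, Matrix.mulVec, dotProduct, Fin.sum_univ_four]

theorem linMatrix_mulVec_mulVec (m n : ℤ) (v : Fin 4 → ℝ) :
    (linMatrix m).mulVec ((linMatrix n).mulVec v) = (linMatrix (m + n)).mulVec v := by
  simp only [linMatrix_mulVec]
  ext i
  fin_cases i <;> simp <;> ring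

theorem linMatrix_zero_mulVec (v : Fin 4 → ℝ) : (linMatrix 0).mulVec v = v := by
  rw [linMatrix_mulVec]
  ext i
  fin_cases i <;> simp

theorem linMatrix_mulVec_transVec (m n : ℤ) : (linMatrix m).mulVec (transVec n) = transVec n := by
  rw [linMatrix_mulVec]
  ext i
  fin_cases i <;> simp [transVec]

theorem transVec_add (m n : ℤ) : transVec (m + n) = transVec n + transVec m := by
  ext i
  fin_cases i <;> simp [transVec, add_comm]

theorem transVec_zero : transVec 0 = 0 := by
  ext i
  fin_cases i <;> simp [transVec]

/-- `λ(n)` as an invertible linear transformation. -/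
noncomputable def linPart (n : ℤ) : (Fin 4 → ℝ) ≃ₗ[ℝ] (Fin 4 → ℝ) where
  toFun v := (linMatrix n).mulVec v
  map_add' v w := Matrix.mulVec_add _ v w
  map_smul' r v := Matrix.mulVec_smul _ r v
  invFun v := (linMatrix (-n)).mulVec v
  left_inv v := by
    beta_reduce
    rw [linMatrix_mulVec_mulVec, neg_add_cancel, linMatrix_zero_mulVec]
  right_inv v := by
    beta_reduce
    rw [linMatrix_mulVec_mulVec, add_neg_cancel, linMatrix_zero_mulVec]

theorem linPart_apply (n : ℤ) (v : Fin 4 → ℝ) : linPart n v = (linMatrix n).mulVec v := rfl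

/-- The affine transformation `γ_n(v) = λ(n) v + τ(n)`. -/
noncomputable def gamma (n : ℤ) : (Fin 4 → ℝ) ≃ᵃ[ℝ] (Fin 4 → ℝ) where
  toFun v := (linMatrix n).mulVec v + transVec n
  invFun v := (linMatrix (-n)).mulVec v + transVec (-n)
  left_inv v := by
    beta_reduce
    rw [Matrix.mulVec_add, linMatrix_mulVec_mulVec, neg_add_cancel, linMatrix_zero_mulVec,
      linMatrix_mulVec_transVec, add_assoc, ← transVec_add, neg_add_cancel, transVec_zero, add_zero]
  right_inv v := by
    beta_reduce
    rw [Matrix.mulVec_add, linMatrix_mulVec_mulVec, add_neg_cancel, linMatrix_zero_mulVec,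
      linMatrix_mulVec_transVec, add_assoc, ← transVec_add, add_neg_cancel, transVec_zero, add_zero]
  linear := linPart n
  map_vadd' p v := by
    simp [linPart_apply, Matrix.mulVec_add, add_assoc]

theorem gamma_apply (n : ℤ) (v : Fin 4 → ℝ) :
    gamma n v = (linMatrix n).mulVec v + transVec n := rfl

theorem gamma_linear_apply (n : ℤ) (v : Fin 4 → ℝ) :
    (gamma n).linear v = (linMatrix n).mulVec v := rfl

theorem gamma_mul (m n : ℤ) : gamma m * gamma n = gamma (m + n) := by
  ext1 v
  change gamma m (gamma n v) = _
  simp only [gamma_apply, Matrix.mulVec_add, linMatrix_mulVec_mulVec, linMatrix_mulVec_transVec,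
    transVec_add, add_assoc]

theorem gamma_zero : gamma 0 = 1 := by
  ext1 v
  change _ = v
  simp [gamma_apply, linMatrix_zero_mulVec, transVec_zero]

/-- The infinite cyclic group `Γ = {γ_n}`, `n ∈ ℤ`. -/
def group : Subgroup ((Fin 4 → ℝ) ≃ᵃ[ℝ] (Fin 4 → ℝ)) where
  carrier := range gamma
  mul_mem' := by
    rintro _ _ ⟨m, rfl⟩ ⟨n, rfl⟩
    exact ⟨m + n, (gamma_mul m n).symm⟩
  one_mem' := ⟨0, gamma_zero⟩
  inv_mem' := by
    rintro _ ⟨n, rfl⟩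
    refine ⟨-n, eq_inv_of_mul_eq_one_left ?_⟩
    rw [gamma_mul, neg_add_cancel, gamma_zero]

theorem gamma_apply_one (n : ℤ) (v : Fin 4 → ℝ) : gamma n v 1 = v 1 + n := by
  simp [gamma_apply, linMatrix_mulVec, transVec]

theorem form_linear (n : ℤ) (v w : Fin 4 → ℝ) :
    form ((gamma n).linear v) ((gamma n).linear w) = form v w := by
  simp only [gamma_linear_apply, linMatrix_mulVec, form_apply]
  simp
  ring

theorem linear_mem_cone (n : ℤ) {v : Fin 4 → ℝ} (hv : v ∈ cone) :
    (gamma n).linear v ∈ cone := by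
  obtain ⟨h₁, h₂⟩ := hv
  refine ⟨by rw [form_linear]; exact h₁, ?_⟩
  rw [form_apply] at h₁
  have h3 : 0 ≤ v 3 := by
    by_contra! h
    nlinarith [sq_nonneg (v 1), sq_nonneg (v 2), sq_nonneg (v 0 + v 3), sq_pos_of_neg h]
  have h0 : 0 ≤ v 0 := by
    by_contra! h
    nlinarith [sq_nonneg (v 1), sq_nonneg (v 2), sq_pos_of_neg h]
  simp only [gamma_linear_apply, linMatrix_mulVec]
  simp
  rcases h3.eq_or_lt with h | h
  · have h2 : v 2 = 0 := by
      rw [← h] at h₁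
      nlinarith [sq_nonneg (v 1), sq_nonneg (v 2)]
    rw [← h, h2]
    simpa using h0
  · have : 0 ≤ (v 0 + n * v 2 + (n : ℝ) ^ 2 / 2 * v 3) * v 3 := by
      nlinarith [sq_nonneg (v 1), sq_nonneg (v 2 + n * v 3)]
    have := nonneg_of_mul_nonneg_left this h
    linarith

end ParabolicExample

open ParabolicExample in
/-- The manifold `ℝ⁴ / Γ`, where `Γ = {γ_n}` is the infinite cyclic group generated by the
parabolic transformation `γ_1`. -/
noncomputable def parabolicManifold : FlatLorentzianManifold (Fin 4 → ℝ) where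
  form := form
  lorentzian :=
    { symm := fun v w => by simp only [form_apply]; ring
      exists_timelike := by
        refine ⟨![1, 0, 0, 1], by simp [form_apply], fun w hw hne => ?_⟩
        simp [form_apply] at hw
        rw [form_apply]
        have h0 : w 0 = - w 3 := by linarith
        by_contra! h
        rw [h0] at h
        have h3 : w 3 = 0 := by nlinarith [sq_nonneg (w 1), sq_nonneg (w 2), sq_nonneg (w 3)]
        have h1 : w 1 = 0 := by nlinarith [sq_nonneg (w 1), sq_nonneg (w 2), sq_nonneg (w 3)]
        have h2 : w 2 = 0 := by nlinarith [sq_nonneg (w 1), sq_nonneg (w 2), sq_nonneg (w 3)]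
        apply hne
        ext i
        fin_cases i <;> simp [h0, h1, h2, h3] }
  cone := cone
  isTimeCone := by
    refine ⟨![1, 0, 0, 1], by simp [form_apply], ?_⟩
    ext v
    simp [cone, form_apply, add_comm]
  group := group
  map_form := by
    rintro _ ⟨n, rfl⟩ v w
    exact form_linear n v w
  map_cone := by
    rintro _ ⟨n, rfl⟩ v
    refine ⟨fun h => ?_, linear_mem_cone n⟩
    have := linear_mem_cone (-n) h
    rwa [gamma_linear_apply, gamma_linear_apply, linMatrix_mulVec_mulVec, neg_add_cancel,
      linMatrix_zero_mulVec] at this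
  free := by
    rintro _ ⟨n, rfl⟩ v h
    have h1 := congrFun h 1
    rw [gamma_apply_one] at h1
    have : n = 0 := by exact_mod_cast (by linarith : (n : ℝ) = 0)
    rw [this, gamma_zero]
  proper := by
    intro K L hK hL
    obtain ⟨a, ha⟩ := hK.isBounded.exists_norm_le
    obtain ⟨b, hb⟩ := hL.isBounded.exists_norm_le
    refine ((finite_Icc (-⌈a + b⌉) ⌈a + b⌉).image gamma).subset ?_
    rintro _ ⟨⟨n, rfl⟩, w, ⟨v, hv, rfl⟩, hw⟩
    refine ⟨n, ?_, rfl⟩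
    have h1 : |v 1| ≤ a := (norm_le_pi_norm v 1).trans (ha v hv)
    have h2 : |gamma n v 1| ≤ b := (norm_le_pi_norm (gamma n v) 1).trans (hb _ hw)
    rw [gamma_apply_one] at h2
    rw [abs_le] at h1 h2
    have h3 := Int.le_ceil (a + b)
    constructor
    · have : (-(⌈a + b⌉ : ℝ)) ≤ n := by linarith
      exact_mod_cast this
    · have : (n : ℝ) ≤ ⌈a + b⌉ := by linarith
      exact_mod_cast this

/-! A segment from `v` to `γ v` projects to a closed path, so in a causal manifold every nontrivial
element of `Γ` moves every point by a spacelike vector. Scaling `v` to infinity shows that `λ - 1`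
has no timelike value for any linear part `λ` (`IsCausal.form_linear_sub_nonpos`).

If the linear parts move a timelike vector `e` in a bounded set, the manifold is elliptic
(`isElliptic_of_bounded`). Otherwise the rescaled vectors `γ_n e` and `γ_n⁻¹ e` accumulate at null
vectors `x`, `y`. Applying the bound on `λ - 1` to the products `h γ_n` forces `h x` onto the line
of `y` for every `h`, so the null line of `x` is invariant; the same bound makes its multiplier 1
(`IsCausal.exists_fixed_null`). Strict causality adds that orbits are isolated even modulo `x`
(`IsStrictlyCausal.isolated`).

In coordinates with `x` as first basis vector, each linear part induces a Euclidean motion `u ↦ A u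
+ b` of a plane. A common fixed point of these motions lifts to a fixed timelike vector, which is
excluded. Were `b = 0` for every element with `A = 1`, the part `A` would determine `b` and a common
fixed point would exist; so some element has `A = 1`, `b ≠ 0`
(`IsStrictlyParabolic.exists_unipotent`). An affine similarity carries it to `gamma 1`. Isolation
and Dirichlet approximation then make all unipotent elements commensurable with `gamma 1`
(`unipotent_eq`), conjugating `gamma 1` shows that every element is unipotent, and `Γ` embeds in `ℝ`
as a discrete subgroup. Its generator can in turn be carried to `gamma 1`. -/

/-! ### Algebra of Lorentzian forms and time cones. -/

namespace IsLorentzianForm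

section Algebra

variable {V : Type*} [AddCommGroup V] [Module ℝ V] {ℓ : LinearMap.BilinForm ℝ V}

/-- The form is negative definite on the orthogonal complement of every timelike vector. -/
theorem neg_of_orthogonal (h : IsLorentzianForm ℓ) {u w : V} (hu : 0 < ℓ u u) (huw : ℓ u w = 0)
    (hw : w ≠ 0) : ℓ w w < 0 := by
  obtain ⟨e, he, hneg⟩ := h.exists_timelike
  by_contra! hww
  have hwu : ℓ w u = 0 := by rw [h.symm, huw]
  -- On the plane of `u` and `w` the form would be nonnegative, but this combination lies in that
  -- plane and is orthogonal to `e`.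
  by_cases hz : ℓ e w • u - ℓ e u • w = 0
  · have h1 : ℓ u (ℓ e w • u - ℓ e u • w) = 0 := by rw [hz, map_zero]
    simp only [map_sub, map_smul, smul_eq_mul, huw, mul_zero, sub_zero, mul_eq_zero, hu.ne',
      or_false] at h1
    exact (hneg w h1 hw).not_ge hww
  · have h1 := hneg _ (by simp [mul_comm]) hz
    simp only [map_sub, map_smul, smul_eq_mul, huw, hwu, LinearMap.sub_apply,
      LinearMap.smul_apply] at h1
    nlinarith [mul_nonneg (mul_self_nonneg (ℓ e u)) hww,
      mul_nonneg (mul_self_nonneg (ℓ e w)) hu.le]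

theorem nonpos_of_orthogonal (h : IsLorentzianForm ℓ) {u w : V} (hu : 0 < ℓ u u)
    (huw : ℓ u w = 0) : ℓ w w ≤ 0 := by
  by_cases hw : w = 0
  · simp [hw]
  · exact (h.neg_of_orthogonal hu huw hw).le

theorem eq_zero_of_orthogonal (h : IsLorentzianForm ℓ) {u w : V} (hu : 0 < ℓ u u)
    (huw : ℓ u w = 0) (hw : 0 ≤ ℓ w w) : w = 0 := by
  by_contra hne
  exact (h.neg_of_orthogonal hu huw hne).not_ge hw

theorem apply_pos (h : IsLorentzianForm ℓ) {e u : V} (he : 0 < ℓ e e) (hu : 0 ≤ ℓ u u)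
    (heu : 0 ≤ ℓ e u) (hne : u ≠ 0) : 0 < ℓ e u :=
  heu.lt_of_ne fun h0 => hne (h.eq_zero_of_orthogonal he h0.symm hu)

/-- The combination is orthogonal to `e`, so negativity on the complement of `e` turns this
expansion into a bound on `ℓ u v`. -/
theorem apply_comb (h : IsLorentzianForm ℓ) (e u v : V) :
    ℓ (ℓ e v • u - ℓ e u • v) (ℓ e v • u - ℓ e u • v) =
      ℓ e v ^ 2 * ℓ u u - 2 * (ℓ e u * ℓ e v) * ℓ u v + ℓ e u ^ 2 * ℓ v v := by
  simp only [map_sub, map_smul, smul_eq_mul, LinearMap.sub_apply, LinearMap.smul_apply,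
    h.symm v u]
  ring

/-- Two vectors of the same time cone have a nonnegative product. -/
theorem apply_nonneg (h : IsLorentzianForm ℓ) {e u v : V} (he : 0 < ℓ e e) (hu : 0 ≤ ℓ u u)
    (heu : 0 ≤ ℓ e u) (hv : 0 ≤ ℓ v v) (hev : 0 ≤ ℓ e v) : 0 ≤ ℓ u v := by
  by_cases hu0 : u = 0
  · simp [hu0]
  by_cases hv0 : v = 0
  · simp [hv0]
  have h1 := h.apply_pos he hu heu hu0
  have h2 := h.apply_pos he hv hev hv0
  have h3 := h.nonpos_of_orthogonal (w := ℓ e v • u - ℓ e u • v) he (by simp [mul_comm])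
  rw [h.apply_comb] at h3
  have h4 : 0 ≤ (ℓ e u * ℓ e v) * ℓ u v := by
    nlinarith [mul_nonneg (sq_nonneg (ℓ e v)) hu, mul_nonneg (sq_nonneg (ℓ e u)) hv]
  exact nonneg_of_mul_nonneg_right h4 (mul_pos h1 h2)

/-- Orthogonal vectors of the same time cone are proportional. -/
theorem proportional_of_apply_eq_zero (h : IsLorentzianForm ℓ) {e u v : V} (he : 0 < ℓ e e)
    (hu : 0 ≤ ℓ u u) (hv : 0 ≤ ℓ v v) (huv : ℓ u v = 0) : ℓ e v • u = ℓ e u • v := by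
  rw [← sub_eq_zero]
  refine h.eq_zero_of_orthogonal he (by simp [mul_comm]) ?_
  rw [h.apply_comb, huv]
  nlinarith [mul_nonneg (sq_nonneg (ℓ e v)) hu, mul_nonneg (sq_nonneg (ℓ e u)) hv]

/-- Strict reversed Cauchy–Schwarz: `u - v` is orthogonal to the timelike vector `u + v`, hence
spacelike. -/
theorem lt_apply (h : IsLorentzianForm ℓ) {u v : V} (hu : 0 < ℓ u u) (huv : ℓ u u = ℓ v v)
    (hnn : 0 ≤ ℓ u v) (hne : u ≠ v) : ℓ u u < ℓ u v := by
  have h1 : ℓ (u + v) (u - v) = 0 := by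
    simp only [map_sub, map_add, LinearMap.add_apply, h.symm v u]
    linarith
  have h2 : 0 < ℓ (u + v) (u + v) := by
    simp only [map_add, LinearMap.add_apply, h.symm v u]
    linarith
  have h3 := h.neg_of_orthogonal h2 h1 (sub_ne_zero.2 hne)
  simp only [map_sub, LinearMap.sub_apply, h.symm v u] at h3
  linarith

theorem convex_timeCone (h : IsLorentzianForm ℓ)
    {e : V} (he : 0 < ℓ e e) : Convex ℝ {v | 0 ≤ ℓ v v ∧ 0 ≤ ℓ e v} := by
  rintro u ⟨hu, heu⟩ v ⟨hv, hev⟩ a b ha hb -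
  have huv := h.apply_nonneg he hu heu hv hev
  simp only [mem_ofPred_eq, map_add, map_smul, LinearMap.add_apply, LinearMap.smul_apply,
    smul_eq_mul, h.symm v u]
  constructor <;> positivity

end Algebra

end IsLorentzianForm

theorem LinearMap.BilinForm.continuous_apply_apply {V : Type*} [NormedAddCommGroup V]
    [NormedSpace ℝ V] [FiniteDimensional ℝ V] (ℓ : LinearMap.BilinForm ℝ V)
    {X : Type*} [TopologicalSpace X] {f g : X → V} (hf : Continuous f) (hg : Continuous g) :
    Continuous fun x => ℓ (f x) (g x) := by
  have h : Continuous ((LinearMap.toContinuousLinearMap :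
      (V →ₗ[ℝ] ℝ) ≃ₗ[ℝ] (V →L[ℝ] ℝ)).toLinearMap ∘ₗ ℓ) :=
    LinearMap.continuous_of_finiteDimensional _
  exact (h.comp hf).clm_apply hg

/-! ### Affine maps and displacements in a causal manifold. -/

namespace AffineEquiv

variable {V W : Type*} [AddCommGroup V] [Module ℝ V] [AddCommGroup W] [Module ℝ W]

theorem apply_eq_linear_add (γ : V ≃ᵃ[ℝ] W) (v : V) : γ v = γ.linear v + γ 0 := by
  simpa using γ.map_vadd 0 v

theorem apply_add (γ : V ≃ᵃ[ℝ] W) (v w : V) : γ (v + w) = γ v + γ.linear w := by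
  rw [apply_eq_linear_add, apply_eq_linear_add γ v, map_add]
  abel

theorem linear_inv_apply_self (γ : V ≃ᵃ[ℝ] V) (v : V) : γ⁻¹.linear (γ.linear v) = v :=
  γ.linear.symm_apply_apply v

theorem linear_self_inv_apply (γ : V ≃ᵃ[ℝ] V) (v : V) : γ.linear (γ⁻¹.linear v) = v :=
  γ.linear.apply_symm_apply v

theorem linear_mul_apply (γ δ : V ≃ᵃ[ℝ] V) (v : V) :
    (γ * δ).linear v = γ.linear (δ.linear v) := rfl

end AffineEquiv

namespace FlatLorentzianManifold

variable {V : Type*} [NormedAddCommGroup V] [NormedSpace ℝ V] [FiniteDimensional ℝ V]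
  {M : FlatLorentzianManifold V}

theorem proj_eq_iff {v w : V} : M.proj v = M.proj w ↔ ∃ γ ∈ M.group, γ v = w :=
  Quotient.eq (r := M.orbitSetoid)

theorem continuous_proj : Continuous M.proj := continuous_quotient_mk'

theorem mem_cone_or_neg_mem {v : V} (hv : 0 ≤ M.form v v) : v ∈ M.cone ∨ -v ∈ M.cone := by
  obtain ⟨e, he, hC⟩ := M.isTimeCone
  rw [hC]
  rcases le_total 0 (M.form e v) with h | h
  · exact Or.inl ⟨hv, h⟩
  · exact Or.inr ⟨by simpa using hv, by simpa using h⟩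

theorem smul_mem_cone {v : V} (hv : v ∈ M.cone) {a : ℝ} (ha : 0 ≤ a) : a • v ∈ M.cone := by
  obtain ⟨e, he, hC⟩ := M.isTimeCone
  rw [hC] at hv ⊢
  obtain ⟨h1, h2⟩ := hv
  refine ⟨?_, ?_⟩ <;> simp only [map_smul, LinearMap.smul_apply, smul_eq_mul] <;> positivity

theorem isSmoothTimelikeOn_segment (v : V) {d : V} (hd : d ∈ M.cone) {a b : ℝ} (hab : a < b) :
    M.IsSmoothTimelikeOn (fun t => M.proj (v + t • d)) a b := by
  intro t _
  refine ⟨univ, isOpen_univ, mem_univ _, fun s => v + s • d, by fun_prop, fun s hs => ⟨rfl, ?_⟩⟩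
  have h : HasDerivAt (fun s : ℝ => v + s • d) d s := by
    simpa using ((hasDerivAt_id s).smul_const d).const_add v
  rw [h.hasDerivWithinAt.derivWithin (uniqueDiffOn_Icc hab s hs.1)]
  exact hd

/-- In a causal manifold no point is causally related to another point of its orbit. -/
theorem IsCausal.eq_one_of_mem_cone (hM : M.IsCausal) {γ : V ≃ᵃ[ℝ] V} (hγ : γ ∈ M.group) {v : V}
    (h : γ v - v ∈ M.cone) : γ = 1 := by
  by_contra hne
  set d := γ v - v with hd
  have hd0 : d ≠ 0 := fun h0 => hne (M.free γ hγ v (sub_eq_zero.1 h0))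
  refine hM ⟨fun t => M.proj (v + t • d), ⟨1, fun i => i, by simp, by simp, fun i hi => ?_⟩, ?_, ?_⟩
  · obtain rfl : i = 0 := by omega
    exact ⟨by simp, isSmoothTimelikeOn_segment v h (by simp)⟩
  · simp only [zero_smul, add_zero, one_smul, hd, add_sub_cancel]
    exact proj_eq_iff.2 ⟨γ, hγ, rfl⟩
  -- If the projection were constant, the whole segment would lie in one orbit, and infinitely many
  -- group elements would send `v` into a compact set.
  · by_contra! hcon
    have hcon' : ∀ t ∈ Icc (0 : ℝ) 1, ∃ δ ∈ M.group, δ v = v + t • d := fun t ht =>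
      proj_eq_iff.1 (by simpa using (hcon t ht).symm)
    choose! δ hδ hδv using hcon'
    have hfin := M.proper {v} ((fun t : ℝ => v + t • d) '' Icc 0 1) isCompact_singleton
      (isCompact_Icc.image (by fun_prop))
    have hinf : (δ '' Icc (0 : ℝ) 1).Infinite := by
      refine (Icc_infinite one_pos).image fun s hs t ht hst => ?_
      have h1 : v + s • d = v + t • d := by rw [← hδv s hs, ← hδv t ht, hst]
      exact smul_left_injective ℝ hd0 (add_left_cancel h1)
    refine hinf (hfin.subset ?_)
    rintro _ ⟨t, ht, rfl⟩
    exact ⟨hδ t ht, δ t v, mem_image_of_mem _ rfl, t, ht, (hδv t ht).symm⟩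

theorem IsCausal.eq_one_of_nonneg (hM : M.IsCausal) {γ : V ≃ᵃ[ℝ] V} (hγ : γ ∈ M.group) {v : V}
    (h : 0 ≤ M.form (γ v - v) (γ v - v)) : γ = 1 := by
  rcases mem_cone_or_neg_mem h with h | h
  · exact hM.eq_one_of_mem_cone hγ h
  · rw [neg_sub] at h
    refine inv_eq_one.1 (hM.eq_one_of_mem_cone (M.group.inv_mem hγ) (v := γ v) ?_)
    rwa [show γ⁻¹ (γ v) = v from γ.symm_apply_apply v]

/-- The range of `λ - 1` contains no timelike vector if `λ` is a linear part of `Γ`. -/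
theorem IsCausal.form_linear_sub_nonpos (hM : M.IsCausal) {γ : V ≃ᵃ[ℝ] V} (hγ : γ ∈ M.group)
    (u : V) : M.form (γ.linear u - u) (γ.linear u - u) ≤ 0 := by
  by_contra! h
  set z := γ.linear u - u with hz
  set τ := γ 0
  -- The displacement of `r • u` is `r • z + τ`. If `z` is timelike, the term quadratic in `r`
  -- dominates for large `r`, so the displacement is not spacelike.
  obtain ⟨r, hr⟩ : ∃ r : ℝ, 0 ≤ M.form (r • z + τ) (r • z + τ) := by
    have h1 : ∀ r : ℝ, M.form (r • z + τ) (r • z + τ) =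
        r ^ 2 * M.form z z + 2 * r * M.form z τ + M.form τ τ := by
      intro r
      simp only [map_add, map_smul, LinearMap.add_apply, LinearMap.smul_apply, smul_eq_mul,
        M.lorentzian.symm τ z]
      ring
    set a := M.form z z
    set b := M.form z τ
    set c := M.form τ τ
    refine ⟨(2 * |b| + |c|) / a + 1, ?_⟩
    rw [h1]
    set r := (2 * |b| + |c|) / a + 1 with hr
    have h2 : r * a = 2 * |b| + |c| + a := by rw [hr]; field_simp
    have h3 : 1 ≤ r := by
      have : 0 ≤ (2 * |b| + |c|) / a := by positivity
      linarith
    have h4 : r ^ 2 * a + 2 * r * b + c = r * (2 * (|b| + b)) + (r - 1) * |c| + (|c| + c) + r * a := by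
      linear_combination r * h2
    rw [h4]
    have h5 := neg_abs_le b
    have h6 := neg_abs_le c
    have h7 : 0 ≤ r * (2 * (|b| + b)) := mul_nonneg (by linarith) (by linarith)
    have h8 : 0 ≤ (r - 1) * |c| := mul_nonneg (by linarith) (abs_nonneg c)
    have h9 : 0 ≤ r * a := by positivity
    linarith
  have h1 : γ (r • u) - r • u = r • z + τ := by
    rw [AffineEquiv.apply_eq_linear_add, map_smul, hz, smul_sub]
    abel
  have h2 := hM.eq_one_of_nonneg hγ (v := r • u) (by rw [h1]; exact hr)
  have h3 : z = 0 := by rw [hz, h2]; exact sub_self u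
  simp [h3] at h

end FlatLorentzianManifold

/-! ### Linear holonomy: ellipticity or a fixed null vector. -/

namespace FlatLorentzianManifold

open Filter

variable {V : Type*} [NormedAddCommGroup V] [NormedSpace ℝ V] [FiniteDimensional ℝ V]
  {M : FlatLorentzianManifold V}

theorem isClosed_timeCone (ℓ : LinearMap.BilinForm ℝ V) (e : V) :
    IsClosed {v | 0 ≤ ℓ v v ∧ 0 ≤ ℓ e v} :=
  (isClosed_le continuous_const (ℓ.continuous_apply_apply continuous_id continuous_id)).inter
    (isClosed_le continuous_const (ℓ.continuous_apply_apply continuous_const continuous_id))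

/-- The functional `ℓ e` has a positive minimum on the compact set of unit vectors of the cone, and
the rest is homogeneity. Slices of the cone by `ℓ e` are therefore bounded. -/
theorem exists_norm_le_of_mem_cone {ℓ : LinearMap.BilinForm ℝ V} (hℓ : IsLorentzianForm ℓ)
    {e : V} (he : 0 < ℓ e e) :
    ∃ K : ℝ, 0 < K ∧ ∀ v, 0 ≤ ℓ v v → 0 ≤ ℓ e v → ‖v‖ ≤ K * ℓ e v := by
  have hS : IsCompact (Metric.sphere (0 : V) 1 ∩ {v | 0 ≤ ℓ v v ∧ 0 ≤ ℓ e v}) :=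
    (isCompact_sphere 0 1).inter_right (isClosed_timeCone ℓ e)
  have key : ∃ m : ℝ, 0 < m ∧
      ∀ v ∈ Metric.sphere (0 : V) 1 ∩ {v | 0 ≤ ℓ v v ∧ 0 ≤ ℓ e v}, m ≤ ℓ e v := by
    rcases (Metric.sphere (0 : V) 1 ∩ {v | 0 ≤ ℓ v v ∧ 0 ≤ ℓ e v}).eq_empty_or_nonempty
      with h | h
    · exact ⟨1, one_pos, by simp [h]⟩
    · obtain ⟨u, hu, hmin⟩ := hS.exists_isMinOn h
        (ℓ.continuous_apply_apply continuous_const continuous_id).continuousOn (f := fun v => ℓ e v)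
      have hu0 : u ≠ 0 := by
        rintro rfl
        simpa using hu.1
      exact ⟨ℓ e u, hℓ.apply_pos he hu.2.1 hu.2.2 hu0, fun v hv => hmin hv⟩
  obtain ⟨m, hm, hmv⟩ := key
  refine ⟨m⁻¹, by positivity, fun v h1 h2 => ?_⟩
  by_cases hv : v = 0
  · simp [hv]
  have hn : 0 < ‖v‖ := norm_pos_iff.2 hv
  have h3 := hmv (‖v‖⁻¹ • v) ⟨by simp [norm_smul, hn.ne'], by
    simp only [map_smul, LinearMap.smul_apply, smul_eq_mul, mem_ofPred_eq]
    constructor <;> positivity⟩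
  rw [map_smul, smul_eq_mul, ← div_eq_inv_mul, le_div_iff₀ hn] at h3
  rw [← div_eq_inv_mul, le_div_iff₀ hm]
  linarith

theorem mem_interior_timeCone (ℓ : LinearMap.BilinForm ℝ V) {e v : V} (hv : 0 < ℓ v v)
    (hev : 0 < ℓ e v) : v ∈ interior {v | 0 ≤ ℓ v v ∧ 0 ≤ ℓ e v} := by
  have ho : IsOpen {v | 0 < ℓ v v ∧ 0 < ℓ e v} :=
    (isOpen_lt continuous_const (ℓ.continuous_apply_apply continuous_id continuous_id)).inter
      (isOpen_lt continuous_const (ℓ.continuous_apply_apply continuous_const continuous_id))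
  have hsub : {v | 0 < ℓ v v ∧ 0 < ℓ e v} ⊆ {v | 0 ≤ ℓ v v ∧ 0 ≤ ℓ e v} :=
    fun w hw => ⟨hw.1.le, hw.2.le⟩
  exact interior_maximal hsub ho ⟨hv, hev⟩

/-- A timelike vector fixed by the linear holonomy makes the manifold elliptic. -/
theorem isElliptic_of_fixed {u : V} (hu : 0 < M.form u u)
    (hfix : ∀ γ ∈ M.group, γ.linear u = u) : M.IsElliptic := by
  obtain ⟨e, he, hC⟩ := M.isTimeCone
  have hu0 : u ≠ 0 := by rintro rfl; simp at hu
  rcases le_total 0 (M.form e u) with h | h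
  · refine ⟨u, ?_, hfix⟩
    rw [hC]
    exact mem_interior_timeCone _ hu (M.lorentzian.apply_pos he hu.le h hu0)
  · have hu' : 0 < M.form (-u) (-u) := by simpa using hu
    refine ⟨-u, ?_, fun γ hγ => by rw [map_neg, hfix γ hγ]⟩
    rw [hC]
    exact mem_interior_timeCone _ hu'
      (M.lorentzian.apply_pos he hu'.le (by simpa using h) (neg_ne_zero.2 hu0))

theorem add_mem_cone {u v : V} (hu : u ∈ M.cone) (hv : v ∈ M.cone) : u + v ∈ M.cone := by
  obtain ⟨e, he, hC⟩ := M.isTimeCone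
  rw [hC] at hu hv ⊢
  have h := M.lorentzian.apply_nonneg he hu.1 hu.2 hv.1 hv.2
  refine ⟨?_, by rw [map_add]; exact add_nonneg hu.2 hv.2⟩
  simp only [map_add, LinearMap.add_apply, M.lorentzian.symm v u]
  linarith [hu.1, hv.1]

/-- If an orbit of the linear holonomy on timelike vectors is bounded, the manifold is elliptic:
the point of the closed convex hull of the orbit where the form is maximal is fixed. -/
theorem isElliptic_of_bounded {e : V} (he : 0 < M.form e e)
    (hC : M.cone = {v | 0 ≤ M.form v v ∧ 0 ≤ M.form e v}) {B : ℝ}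
    (hB : ∀ γ ∈ M.group, M.form e (γ.linear e) ≤ B) : M.IsElliptic := by
  have hℓ := M.lorentzian
  set O : Set V := {v | ∃ γ ∈ M.group, γ.linear e = v}
  have heC : e ∈ M.cone := by rw [hC]; exact ⟨he.le, he.le⟩
  have hOC : O ⊆ M.cone := by
    rintro _ ⟨γ, hγ, rfl⟩
    exact (M.map_cone γ hγ e).2 heC
  have hconv : Convex ℝ M.cone := by rw [hC]; exact hℓ.convex_timeCone he
  have hcl : IsClosed M.cone := by rw [hC]; exact isClosed_timeCone _ _
  set K := closure (convexHull ℝ O)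
  have hKC : K ⊆ M.cone := closure_minimal (convexHull_min hOC hconv) hcl
  obtain ⟨R, hR, hRv⟩ := exists_norm_le_of_mem_cone hℓ he
  have hObd : Bornology.IsBounded O := by
    rw [isBounded_iff_forall_norm_le]
    refine ⟨R * B, ?_⟩
    rintro _ ⟨γ, hγ, rfl⟩
    have h1 := hOC ⟨γ, hγ, rfl⟩
    rw [hC] at h1
    exact (hRv _ h1.1 h1.2).trans (mul_le_mul_of_nonneg_left (hB γ hγ) hR.le)
  have hKcomp : IsCompact K :=
    Metric.isCompact_of_isClosed_isBounded isClosed_closure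
      ((isBounded_convexHull.2 hObd).closure)
  have heO : e ∈ O := ⟨1, M.group.one_mem, rfl⟩
  have heK : e ∈ K := subset_closure (subset_convexHull ℝ O heO)
  obtain ⟨u, huK, hmax⟩ := hKcomp.exists_isMaxOn ⟨e, heK⟩
    (M.form.continuous_apply_apply continuous_id continuous_id).continuousOn
    (f := fun v => M.form v v)
  have hu : 0 < M.form u u := he.trans_le (hmax heK)
  refine isElliptic_of_fixed hu fun γ hγ => ?_
  have hmaps : MapsTo γ.linear K K := by
    have h1 : MapsTo γ.linear (convexHull ℝ O) (convexHull ℝ O) := by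
      rw [mapsTo_iff_image_subset]
      refine ((γ.linear : V →ₗ[ℝ] V).image_convexHull O).subset.trans (convexHull_mono ?_)
      rintro _ ⟨_, ⟨δ, hδ, rfl⟩, rfl⟩
      exact ⟨γ * δ, M.group.mul_mem hγ hδ, rfl⟩
    exact h1.closure (γ.linear : V →ₗ[ℝ] V).continuous_of_finiteDimensional
  have hγu := hmaps huK
  by_contra hne
  have hnn : 0 ≤ M.form u (γ.linear u) := by
    have h1 := hKC huK
    have h2 := hKC hγu
    rw [hC] at h1 h2
    exact hℓ.apply_nonneg he h1.1 h1.2 h2.1 h2.2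
  -- If `γ u ≠ u`, their midpoint lies in `K` and has a larger square than `u`.
  have h3 := hℓ.lt_apply hu (M.map_form γ hγ u u).symm hnn (Ne.symm hne)
  have hKconv : Convex ℝ K := (convex_convexHull ℝ O).closure
  have h4 : (1 / 2 : ℝ) • u + (1 / 2 : ℝ) • γ.linear u ∈ K :=
    hKconv huK hγu (by norm_num) (by norm_num) (by norm_num)
  have h5 := hmax h4
  simp only [mem_ofPred_eq, map_add, map_smul, LinearMap.add_apply, LinearMap.smul_apply,
    smul_eq_mul, hℓ.symm (γ.linear u) u, M.map_form γ hγ u u] at h5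
  linarith

/-- A causal manifold that is not elliptic has linear holonomy of parabolic type: there is a null
vector, unique up to a factor, whose direction is fixed. -/
theorem IsCausal.exists_null_direction (hM : M.IsCausal) (hne : ¬ M.IsElliptic) :
    ∃ x ∈ M.cone, x ≠ 0 ∧ M.form x x = 0 ∧ ∀ γ ∈ M.group, ∃ c : ℝ, c ≠ 0 ∧ γ.linear x = c • x := by
  obtain ⟨e, he, hC⟩ := M.isTimeCone
  have hℓ := M.lorentzian
  have hunb : ∀ n : ℕ, ∃ γ ∈ M.group, (n : ℝ) + 1 < M.form e (γ.linear e) := by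
    by_contra! h
    obtain ⟨n, hn⟩ := h
    exact hne (isElliptic_of_bounded he hC hn)
  choose γ hγ hm using hunb
  set m : ℕ → ℝ := fun n => M.form e ((γ n).linear e)
  have hmpos : ∀ n, 0 < m n := fun n => lt_trans (by positivity) (hm n)
  have hmtop : Tendsto m atTop atTop :=
    tendsto_atTop_mono (fun n => (hm n).le)
      (tendsto_atTop_add_const_right _ _ tendsto_natCast_atTop_atTop)
  have hminv : Tendsto (fun n => (m n)⁻¹) atTop (𝓝 0) := hmtop.inv_tendsto_atTop
  have heC : e ∈ M.cone := by rw [hC]; exact ⟨he.le, he.le⟩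
  set S : Set V := {v | (0 ≤ M.form v v ∧ 0 ≤ M.form e v) ∧ M.form e v = 1}
  obtain ⟨R, hR, hRv⟩ := exists_norm_le_of_mem_cone hℓ he
  have hScomp : IsCompact S := by
    refine Metric.isCompact_of_isClosed_isBounded ((isClosed_timeCone _ _).inter
      (isClosed_eq (M.form.continuous_apply_apply continuous_const continuous_id)
        continuous_const)) ?_
    rw [isBounded_iff_forall_norm_le]
    refine ⟨R * 1, fun v hv => ?_⟩
    have := hRv v hv.1.1 hv.1.2
    rwa [hv.2] at this
  have hinv : ∀ n, M.form e ((γ n)⁻¹.linear e) = m n := fun n => by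
    rw [← M.map_form (γ n) (hγ n), AffineEquiv.linear_self_inv_apply, hℓ.symm]
  have hscale : ∀ (n : ℕ) (w : V), w ∈ M.cone → M.form e w = m n → (m n)⁻¹ • w ∈ S := by
    intro n w hw hmw
    have h1 := smul_mem_cone hw (inv_nonneg.2 (hmpos n).le)
    rw [hC] at h1
    refine ⟨h1, ?_⟩
    rw [map_smul, smul_eq_mul, hmw, inv_mul_cancel₀ (hmpos n).ne']
  have hx : ∀ n, (m n)⁻¹ • (γ n).linear e ∈ S := fun n =>
    hscale n _ ((M.map_cone _ (hγ n) e).2 heC) rfl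
  have hy : ∀ n, (m n)⁻¹ • (γ n)⁻¹.linear e ∈ S := fun n =>
    hscale n _ ((M.map_cone _ (M.group.inv_mem (hγ n)) e).2 heC) (hinv n)
  -- Both rescaled sequences stay in the compact slice `S`, because `γ` and `γ⁻¹` give the same
  -- value of `m`. The squares of their terms are `ℓ(e, e) / m ^ 2`, so the limits are null.
  obtain ⟨⟨x, y⟩, ⟨hxS, hyS⟩, σ, hσ, hlim⟩ :=
    (hScomp.prod hScomp).tendsto_subseq (x := fun n => ((m n)⁻¹ • (γ n).linear e,
      (m n)⁻¹ • (γ n)⁻¹.linear e)) fun n => ⟨hx n, hy n⟩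
  have hlimx : Tendsto (fun n => (m (σ n))⁻¹ • (γ (σ n)).linear e) atTop (𝓝 x) :=
    hlim.fst_nhds
  have hlimy : Tendsto (fun n => (m (σ n))⁻¹ • (γ (σ n))⁻¹.linear e) atTop (𝓝 y) :=
    hlim.snd_nhds
  have hlimm : Tendsto (fun n => (m (σ n))⁻¹) atTop (𝓝 0) := hminv.comp hσ.tendsto_atTop
  have hq : Continuous fun v => M.form v v :=
    M.form.continuous_apply_apply continuous_id continuous_id
  have hnull : ∀ (z : V) (δ : ℕ → V ≃ᵃ[ℝ] V), (∀ n, δ n ∈ M.group) →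
      Tendsto (fun n => (m (σ n))⁻¹ • (δ n).linear e) atTop (𝓝 z) → M.form z z = 0 := by
    intro z δ hδ hz
    have h1 := (hq.tendsto z).comp hz
    have h2 : Tendsto (fun n => (m (σ n))⁻¹ * ((m (σ n))⁻¹ * M.form e e)) atTop (𝓝 0) := by
      simpa using hlimm.mul (hlimm.mul_const (M.form e e))
    refine tendsto_nhds_unique h1 (h2.congr fun n => ?_)
    simp [M.map_form (δ n) (hδ n)]
  have hxx := hnull x (fun n => γ (σ n)) (fun n => hγ _) hlimx
  have hyy := hnull y (fun n => (γ (σ n))⁻¹) (fun n => M.group.inv_mem (hγ _)) hlimy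
  have hx0 : x ≠ 0 := by
    rintro rfl
    simpa using hxS.2
  have hprop : ∀ h ∈ M.group, M.form e (h.linear x) • y = h.linear x := by
    intro h hh
    have hhx : h.linear x ∈ M.cone := (M.map_cone h hh x).2 (by rw [hC]; exact hxS.1)
    rw [hC] at hhx
    -- The vector `h x + y` is a limit of values of `λ - 1`, where `λ` is the linear part of `h γ_n`
    -- and the argument is `(e - γ_n⁻¹ e) / m`. Its square `2 ℓ(h x, y)` is thus nonpositive, while
    -- two vectors of one cone have a nonnegative product.
    have h0 : M.form (h.linear x) y ≤ 0 := by
      have hcont : Continuous h.linear :=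
        (h.linear : V →ₗ[ℝ] V).continuous_of_finiteDimensional
      have t1 : Tendsto (fun n => h.linear ((m (σ n))⁻¹ • (γ (σ n)).linear e) +
          (m (σ n))⁻¹ • (γ (σ n))⁻¹.linear e - (m (σ n))⁻¹ • (e + h.linear e)) atTop
          (𝓝 (h.linear x + y - (0 : ℝ) • (e + h.linear e))) :=
        (((hcont.tendsto x).comp hlimx).add hlimy).sub (hlimm.smul_const _)
      have t2 := (hq.tendsto _).comp t1
      have t3 : M.form (h.linear x + y - (0 : ℝ) • (e + h.linear e))
          (h.linear x + y - (0 : ℝ) • (e + h.linear e)) ≤ 0 := by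
        refine le_of_tendsto t2 (Eventually.of_forall fun n => ?_)
        set g := γ (σ n)
        set a := (m (σ n))⁻¹
        have h1 := hM.form_linear_sub_nonpos (M.group.mul_mem hh (hγ (σ n)))
          (a • (e - g⁻¹.linear (h⁻¹.linear (h.linear e))))
        have h2 : (h * g).linear (a • (e - g⁻¹.linear (h⁻¹.linear (h.linear e)))) -
            a • (e - g⁻¹.linear (h⁻¹.linear (h.linear e))) =
            h.linear (a • g.linear e) + a • g⁻¹.linear e - a • (e + h.linear e) := by
          rw [AffineEquiv.linear_inv_apply_self, AffineEquiv.linear_mul_apply, map_smul, map_smul, map_sub,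
            AffineEquiv.linear_self_inv_apply, map_sub, map_smul]
          simp only [smul_sub, smul_add]
          abel
        rw [h2] at h1
        exact h1
      simp only [zero_smul, sub_zero, map_add, LinearMap.add_apply, hyy,
        M.map_form h hh x x, hxx, hℓ.symm y (h.linear x)] at t3
      linarith
    have h1 : M.form (h.linear x) y = 0 :=
      le_antisymm h0 (hℓ.apply_nonneg he hhx.1 hhx.2 hyS.1.1 hyS.1.2)
    have h2 := hℓ.proportional_of_apply_eq_zero he hhx.1 hyS.1.1 h1
    rw [hyS.2, one_smul] at h2
    exact h2.symm
  refine ⟨x, by rw [hC]; exact hxS.1, hx0, hxx, fun h hh => ⟨M.form e (h.linear x), ?_, ?_⟩⟩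
  · intro h0
    have h1 := hprop h hh
    rw [h0, zero_smul] at h1
    exact hx0 (h.linear.map_eq_zero_iff.1 h1.symm)
  -- The case `h = 1` identifies `y` with `x`.
  · have h1 := hprop 1 M.group.one_mem
    change M.form e x • y = x at h1
    rw [hxS.2, one_smul] at h1
    subst h1
    exact (hprop h hh).symm

/-- A causal manifold that is not elliptic has a null vector fixed by the linear holonomy. -/
theorem IsCausal.exists_fixed_null (hM : M.IsCausal) (hne : ¬ M.IsElliptic) :
    ∃ x ∈ M.cone, x ≠ 0 ∧ M.form x x = 0 ∧ ∀ γ ∈ M.group, γ.linear x = x := by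
  obtain ⟨x, hxC, hx0, hxx, hfix⟩ := hM.exists_null_direction hne
  refine ⟨x, hxC, hx0, hxx, fun γ hγ => ?_⟩
  obtain ⟨c, hc0, hc⟩ := hfix γ hγ
  obtain ⟨e, he, -⟩ := M.isTimeCone
  have hℓ := M.lorentzian
  have hex : M.form e x ≠ 0 := fun h => hx0 (hℓ.eq_zero_of_orthogonal he h hxx.ge)
  suffices c = 1 by rw [hc, this, one_smul]
  by_contra hc1
  set z := γ.linear e - e with hz
  have h1 : c * M.form (γ.linear e) x = M.form e x := by
    rw [← M.map_form γ hγ e x, hc, map_smul, smul_eq_mul]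
  have h2 : M.form z x ≠ 0 := by
    intro h
    rw [hz, map_sub, LinearMap.sub_apply] at h
    have : (c - 1) * M.form e x = 0 := by linear_combination h1 - c * h
    rcases mul_eq_zero.1 this with h | h
    · exact hc1 (by linarith)
    · exact hex h
  have h3 : ∀ r : ℝ, γ.linear (e + (r / (c - 1)) • x) - (e + (r / (c - 1)) • x) = z + r • x := by
    intro r
    have hc2 : r / (c - 1) * c - r / (c - 1) = r := by
      have := sub_ne_zero.2 hc1
      field_simp
    rw [map_add, map_smul, hc, smul_smul, ← hc2, sub_smul, hz, hc2]
    abel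
  -- If `c ≠ 1`, the range of `λ - 1` contains all `z + r • x`. Since `ℓ(z, x) ≠ 0`, the square is a
  -- nonconstant affine function of `r`; this `r` makes it equal to 1.
  have h4 := hM.form_linear_sub_nonpos hγ
    (e + (((1 - M.form z z) / (2 * M.form z x)) / (c - 1)) • x)
  rw [h3] at h4
  simp only [map_add, map_smul, LinearMap.add_apply, LinearMap.smul_apply, smul_eq_mul, hxx,
    hℓ.symm x z] at h4
  have h5 : (1 - M.form z z) / (2 * M.form z x) * M.form z x = (1 - M.form z z) / 2 := by
    field_simp
  linarith

/-! ### Strict causality: orbits modulo the null direction. -/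

/-- In a strictly causal manifold, the orbits are isolated, with multiplicity, modulo a null
direction fixed by the linear holonomy. -/
theorem IsStrictlyCausal.isolated (hM : M.IsStrictlyCausal) {x : V} (hxC : x ∈ M.cone)
    (hx0 : x ≠ 0) (v : V) :
    ∃ N ∈ 𝓝 v, ∀ γ ∈ M.group, ∀ a : ℝ, γ v + a • x ∈ N → γ = 1 := by
  obtain ⟨hc, hU⟩ := hM
  obtain ⟨U, hUp, hF, hP⟩ := hU (M.proj v)
  obtain ⟨e, he, hC⟩ := M.isTimeCone
  have hℓ := M.lorentzian
  have hnegx : ∀ a : ℝ, a < 0 → a • x ∉ M.cone := by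
    intro a ha h
    rw [hC] at hxC h
    have h1 := hℓ.apply_pos he hxC.1 hxC.2 hx0
    have h2 := h.2
    rw [map_smul, smul_eq_mul] at h2
    nlinarith
  have hsm : ∀ a : ℝ, 0 ≤ a → a • x ∈ M.cone := fun a ha => smul_mem_cone hxC ha
  -- points of the line through `v` near `v` project to the interior of `U`
  obtain ⟨ε, hε, hεU⟩ : ∃ ε : ℝ, 0 < ε ∧ ∀ a : ℝ, |a| < ε → U ∈ 𝓝 (M.proj (v + a • x)) := by
    have hcont : Continuous fun a : ℝ => M.proj (v + a • x) :=
      continuous_proj.comp (by fun_prop)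
    have h1 : ∀ᶠ a in 𝓝 (0 : ℝ), U ∈ 𝓝 (M.proj (v + a • x)) := by
      refine hcont.continuousAt.eventually (p := fun q => U ∈ 𝓝 q) ?_
      simpa using eventually_mem_nhds_iff.2 hUp
    obtain ⟨ε, hε, h⟩ := Metric.eventually_nhds_iff.1 h1
    exact ⟨ε, hε, fun a ha => h (by simpa using ha)⟩
  have hclosed : ∀ (F : Set M.Carrier), IsClosed ((fun q : U => (q : M.Carrier)) ⁻¹' F) →
      ∀ a : ℝ, |a| < ε → v + a • x ∈ closure (M.proj ⁻¹' F) → M.proj (v + a • x) ∈ F := by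
    intro F hF a ha hcl
    obtain ⟨Z, hZ, hZF⟩ := isClosed_induced_iff.1 hF
    have hUa := hεU a ha
    have h1 : M.proj (v + a • x) ∈ closure (F ∩ U) := by
      have h2 : M.proj (v + a • x) ∈ closure F :=
        map_mem_closure continuous_proj hcl fun w hw => hw
      rw [mem_closure_iff_nhds] at h2 ⊢
      intro t ht
      obtain ⟨q, hq, hqF⟩ := h2 (t ∩ U) (inter_mem ht hUa)
      exact ⟨q, hq.1, hqF, hq.2⟩
    have h3 : F ∩ U ⊆ Z := by
      rintro q ⟨hqF, hqU⟩
      have : (⟨q, hqU⟩ : U) ∈ (fun q : U => (q : M.Carrier)) ⁻¹' F := hqF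
      rw [← hZF] at this
      exact this
    have h4 := closure_minimal h3 hZ h1
    have : (⟨_, mem_of_mem_nhds hUa⟩ : U) ∈ (fun q : U => (q : M.Carrier)) ⁻¹' Z := h4
    rw [hZF] at this
    exact this
  -- By relative closedness, a point of this closure would project into the future of `v` while
  -- lying in its past. Causality makes the resulting group element trivial, which puts `-(ε / 2) •
  -- x` in the cone.
  have hfut : v + (-(ε / 2)) • x ∉ closure (M.proj ⁻¹' M.future (M.proj v)) := by
    intro hcl
    obtain ⟨w, hw, c, hcC, hwc⟩ := hclosed _ hF (-(ε / 2)) (by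
      rw [abs_neg, abs_of_pos (by positivity)]; linarith) hcl
    obtain ⟨δ, hδ, rfl⟩ := proj_eq_iff.1 hw.symm
    obtain ⟨δ', hδ', hwc⟩ := proj_eq_iff.1 hwc
    rw [AffineEquiv.apply_add] at hwc
    have hc' := (M.map_cone δ' hδ' c).2 hcC
    have h1 : (δ' * δ)⁻¹ = 1 := by
      refine hc.eq_one_of_mem_cone (M.group.inv_mem (M.group.mul_mem hδ' hδ)) (v := δ' (δ v)) ?_
      rw [show (δ' * δ)⁻¹ (δ' (δ v)) = v from (δ' * δ).symm_apply_apply v]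
      have h2 : v - δ' (δ v) = δ'.linear c + (ε / 2) • x := by
        rw [neg_smul] at hwc
        rw [eq_add_neg_iff_add_eq] at hwc
        rw [sub_eq_iff_eq_add]
        exact hwc.symm.trans (by abel)
      rw [h2]
      exact add_mem_cone hc' (hsm (ε / 2) (by positivity))
    have h2 : δ' (δ v) = v := by
      rw [inv_eq_one] at h1
      exact congrArg (fun γ : V ≃ᵃ[ℝ] V => γ v) h1
    rw [h2] at hwc
    refine hnegx (-(ε / 2)) (by linarith) ?_
    rwa [← add_left_cancel hwc]
  have hpast : v + (ε / 2) • x ∉ closure (M.proj ⁻¹' M.past (M.proj v)) := by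
    intro hcl
    obtain ⟨w, hw, c, hcC, hwc⟩ := hclosed _ hP (ε / 2) (by
      rw [abs_of_pos (by positivity)]; linarith) hcl
    obtain ⟨δ, hδ, rfl⟩ := proj_eq_iff.1 hw.symm
    obtain ⟨δ', hδ', hwc⟩ := proj_eq_iff.1 hwc
    rw [sub_eq_add_neg, AffineEquiv.apply_add, map_neg] at hwc
    have hc' := (M.map_cone δ' hδ' c).2 hcC
    have h1 : δ' * δ = 1 := by
      refine hc.eq_one_of_mem_cone (M.group.mul_mem hδ' hδ) (v := v) ?_
      have h2 : (δ' * δ) v - v = δ'.linear c + (ε / 2) • x := by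
        change δ' (δ v) - v = _
        rw [add_neg_eq_iff_eq_add] at hwc
        rw [sub_eq_iff_eq_add]
        exact hwc.trans (by abel)
      rw [h2]
      exact add_mem_cone hc' (hsm (ε / 2) (by positivity))
    have h2 : δ' (δ v) = v := congrArg (fun γ : V ≃ᵃ[ℝ] V => γ v) h1
    rw [h2] at hwc
    refine hnegx (-(ε / 2)) (by linarith) ?_
    rw [neg_smul, ← add_left_cancel hwc, neg_neg]
    exact hc'
  rw [← mem_compl_iff, ← interior_compl, mem_interior_iff_mem_nhds, Metric.mem_nhds_iff] at hfut hpast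
  obtain ⟨r₁, hr₁, hb₁⟩ := hfut
  obtain ⟨r₂, hr₂, hb₂⟩ := hpast
  -- If `a` exceeds `ε / 2`, moving back by `(ε / 2) • x` gives a point of the future of `v` near `v
  -- - (ε / 2) • x`; for `a < -(ε / 2)` use the past.
  have hsmall : ∀ γ ∈ M.group, ∀ a : ℝ, γ v + a • x ∈ Metric.ball v (min r₁ r₂) →
      a ∈ Icc (-(ε / 2)) (ε / 2) := by
    intro γ hγ a ha
    have hγv : M.proj (γ v) = M.proj v := (proj_eq_iff.2 ⟨γ, hγ, rfl⟩).symm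
    rw [mem_ball_iff_norm, lt_min_iff] at ha
    constructor <;> by_contra! h
    · refine hb₂ (a := γ v + (a + ε / 2) • x) ?_ ?_
      · rw [mem_ball_iff_norm]
        refine lt_of_eq_of_lt (congrArg _ ?_) ha.2
        rw [add_smul]
        abel
      · refine ⟨γ v, hγv, (-(a + ε / 2)) • x, hsm _ (by linarith), ?_⟩
        rw [neg_smul, sub_neg_eq_add]
    · refine hb₁ (a := γ v + (a + -(ε / 2)) • x) ?_ ?_
      · rw [mem_ball_iff_norm]
        refine lt_of_eq_of_lt (congrArg _ ?_) ha.1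
        rw [add_smul]
        abel
      · exact ⟨γ v, hγv, (a + -(ε / 2)) • x, hsm _ (by linarith), rfl⟩
  set L : Set V := (fun q : V × ℝ => q.1 - q.2 • x) ''
    (Metric.closedBall v (min r₁ r₂) ×ˢ Icc (-(ε / 2)) (ε / 2))
  have hL : IsCompact L := ((isCompact_closedBall _ _).prod isCompact_Icc).image (by fun_prop)
  have hfin := M.proper {v} L isCompact_singleton hL
  set G := {γ : V ≃ᵃ[ℝ] V | γ ∈ M.group ∧ (γ '' {v} ∩ L).Nonempty}
  -- With `a` bounded, properness leaves finitely many segments. By causality none passes through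
  -- `v`, so their union can be removed from the ball.
  set lines : Set V := ⋃ γ ∈ G \ {1}, (fun a : ℝ => γ v + a • x) '' Icc (-(ε / 2)) (ε / 2)
  have hlines : IsClosed lines :=
    (hfin.subset sdiff_subset).isClosed_biUnion fun γ _ =>
      (isCompact_Icc.image (by fun_prop)).isClosed
  have hvl : v ∉ lines := by
    simp only [lines, mem_iUnion, not_exists]
    rintro γ ⟨⟨hγ, -⟩, hγ1⟩ ⟨a, -, ha⟩
    refine hγ1 (hc.eq_one_of_nonneg hγ (v := v) ?_)
    have h1 : γ v - v = (-a) • x := by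
      rw [sub_eq_iff_eq_add, neg_smul, eq_neg_add_iff_add_eq, add_comm]
      exact ha
    rw [h1]
    simp only [map_smul, LinearMap.smul_apply, smul_eq_mul]
    rw [hC] at hxC
    nlinarith [mul_nonneg (mul_self_nonneg a) hxC.1]
  refine ⟨Metric.ball v (min r₁ r₂) ∩ linesᶜ,
    inter_mem (Metric.ball_mem_nhds _ (lt_min hr₁ hr₂)) (hlines.isOpen_compl.mem_nhds hvl), ?_⟩
  rintro γ hγ a ⟨ha, hal⟩
  by_contra hγ1
  have haI := hsmall γ hγ a ha
  refine hal (mem_iUnion₂.2 ⟨γ, ⟨⟨hγ, γ v, mem_image_of_mem _ rfl, ?_⟩, hγ1⟩, a, haI, rfl⟩)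
  exact ⟨(γ v + a • x, a), ⟨Metric.ball_subset_closedBall ha, haI⟩, by simp⟩

end FlatLorentzianManifold

/-! ### Reduction to a statement invariant under affine similarities. -/

namespace AffineEquiv

variable {V W : Type*} [AddCommGroup V] [Module ℝ V] [AddCommGroup W] [Module ℝ W]

/-- Conjugation by an affine isomorphism. -/
def conjHom (g : V ≃ᵃ[ℝ] W) : (V ≃ᵃ[ℝ] V) →* (W ≃ᵃ[ℝ] W) where
  toFun γ := (g.symm.trans γ).trans g
  map_one' := by
    ext1 w
    exact g.apply_symm_apply w
  map_mul' γ δ := by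
    ext1 w
    change g (γ (δ (g.symm w))) = g (γ (g.symm (g (δ (g.symm w)))))
    rw [g.symm_apply_apply]

theorem conjHom_apply (g : V ≃ᵃ[ℝ] W) (γ : V ≃ᵃ[ℝ] V) (v : V) :
    conjHom g γ (g v) = g (γ v) := by
  change g (γ (g.symm (g v))) = _
  rw [g.symm_apply_apply]

theorem conjHom_linear_apply (g : V ≃ᵃ[ℝ] W) (γ : V ≃ᵃ[ℝ] V) (v : V) :
    (conjHom g γ).linear (g.linear v) = g.linear (γ.linear v) := by
  change g.linear (γ.linear (g.linear.symm (g.linear v))) = _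
  rw [g.linear.symm_apply_apply]

end AffineEquiv

/-- The properties of the fundamental group of a strictly causal, not elliptic, manifold that
determine it: it keeps the form `ℓ` and the null vector `x`, displacements are spacelike,
orbits are isolated modulo `x`, and no timelike vector is fixed. -/
structure IsStrictlyParabolic {V : Type*} [NormedAddCommGroup V] [NormedSpace ℝ V]
    (ℓ : LinearMap.BilinForm ℝ V) (x : V) (Γ : Subgroup (V ≃ᵃ[ℝ] V)) : Prop where
  map_form : ∀ γ ∈ Γ, ∀ v w, ℓ (γ.linear v) (γ.linear w) = ℓ v w
  map_null : ∀ γ ∈ Γ, γ.linear x = x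
  eq_one : ∀ γ ∈ Γ, ∀ v, 0 ≤ ℓ (γ v - v) (γ v - v) → γ = 1
  isolated : ∀ v, ∃ N ∈ 𝓝 v, ∀ γ ∈ Γ, ∀ a : ℝ, γ v + a • x ∈ N → γ = 1
  not_fixed : ∀ u, 0 < ℓ u u → ∃ γ ∈ Γ, γ.linear u ≠ u

/-- Needed for the passage to null coordinates and for the normalization of a unipotent element. The
latter rescales the null vector, possibly with a negative factor, hence `k`. -/
theorem IsStrictlyParabolic.conj {V W : Type*} [NormedAddCommGroup V] [NormedSpace ℝ V]
    [NormedAddCommGroup W] [NormedSpace ℝ W] [FiniteDimensional ℝ W]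
    {ℓ : LinearMap.BilinForm ℝ V} {x : V} {Γ : Subgroup (V ≃ᵃ[ℝ] V)}
    (h : IsStrictlyParabolic ℓ x Γ) {ℓ' : LinearMap.BilinForm ℝ W} {y : W} (g : V ≃ᵃ[ℝ] W)
    {t k : ℝ} (ht : 0 < t) (hk : k ≠ 0)
    (hform : ∀ v w, ℓ' (g.linear v) (g.linear w) = t * ℓ v w) (hx : g.linear x = k • y) :
    IsStrictlyParabolic ℓ' y (Γ.map g.conjHom) where
  map_form := by
    rintro _ ⟨γ, hγ, rfl⟩ v w
    obtain ⟨v, rfl⟩ := g.linear.surjective v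
    obtain ⟨w, rfl⟩ := g.linear.surjective w
    rw [AffineEquiv.conjHom_linear_apply, AffineEquiv.conjHom_linear_apply, hform, hform,
      h.map_form γ hγ]
  map_null := by
    rintro _ ⟨γ, hγ, rfl⟩
    have hy : y = g.linear (k⁻¹ • x) := by rw [map_smul, hx, smul_smul, inv_mul_cancel₀ hk, one_smul]
    rw [hy, AffineEquiv.conjHom_linear_apply, map_smul γ.linear, h.map_null γ hγ]
  eq_one := by
    rintro _ ⟨γ, hγ, rfl⟩ v hv
    obtain ⟨v, rfl⟩ := g.surjective v
    have h1 : g (γ v) - g v = g.linear (γ v - v) := by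
      rw [sub_eq_iff_eq_add', ← AffineEquiv.apply_add, add_sub_cancel]
    rw [AffineEquiv.conjHom_apply, h1, hform] at hv
    rw [h.eq_one γ hγ v (nonneg_of_mul_nonneg_right hv ht), map_one]
  isolated := by
    intro w
    obtain ⟨v, rfl⟩ := g.surjective w
    obtain ⟨N, hN, hiso⟩ := h.isolated v
    have hcont : Continuous g.symm := by
      have h1 : (g.symm : W → V) = fun w => g.symm.linear w + g.symm 0 :=
        funext fun w => AffineEquiv.apply_eq_linear_add _ w
      rw [h1]
      exact ((g.symm.linear : W →ₗ[ℝ] V).continuous_of_finiteDimensional).add continuous_const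
    refine ⟨g.symm ⁻¹' N, hcont.continuousAt.preimage_mem_nhds (by simpa using hN), ?_⟩
    rintro _ ⟨γ, hγ, rfl⟩ a ha
    have h1 : g (γ v) + a • y = g (γ v + (a * k⁻¹) • x) := by
      rw [AffineEquiv.apply_add, map_smul, hx, smul_smul, mul_assoc, inv_mul_cancel₀ hk, mul_one]
    rw [AffineEquiv.conjHom_apply, h1, mem_preimage, g.symm_apply_apply] at ha
    rw [hiso γ hγ _ ha, map_one]
  not_fixed := by
    intro u hu
    obtain ⟨u, rfl⟩ := g.linear.surjective u
    rw [hform] at hu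
    obtain ⟨γ, hγ, hne⟩ := h.not_fixed u (pos_of_mul_pos_right hu ht.le)
    refine ⟨_, ⟨γ, hγ, rfl⟩, ?_⟩
    rw [AffineEquiv.conjHom_linear_apply]
    exact fun h => hne (g.linear.injective h)

theorem FlatLorentzianManifold.IsStrictlyCausal.exists_isStrictlyParabolic {V : Type*}
    [NormedAddCommGroup V] [NormedSpace ℝ V] [FiniteDimensional ℝ V]
    {M : FlatLorentzianManifold V} (hM : M.IsStrictlyCausal) (hne : ¬ M.IsElliptic) :
    ∃ x, x ≠ 0 ∧ M.form x x = 0 ∧ IsStrictlyParabolic M.form x M.group := by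
  obtain ⟨x, hxC, hx0, hxx, hfix⟩ := hM.1.exists_fixed_null hne
  refine ⟨x, hx0, hxx, M.map_form, hfix, fun γ hγ v => hM.1.eq_one_of_nonneg hγ,
    hM.isolated hxC hx0, fun u hu => ?_⟩
  by_contra! hcon
  exact hne (isElliptic_of_fixed hu hcon)

/-! ### Null coordinates. -/

theorem exists_notMem_span_of_card_lt {V : Type*} [AddCommGroup V] [Module ℝ V]
    [FiniteDimensional ℝ V] [DecidableEq V] (s : Finset V) (hs : s.card < Module.finrank ℝ V) :
    ∃ z, z ∉ Submodule.span ℝ (s : Set V) := by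
  have h := Submodule.lt_top_of_finrank_lt_finrank ((finrank_span_finset_le_card s).trans_lt hs)
  obtain ⟨z, -, hz⟩ := SetLike.exists_of_lt h
  exact ⟨z, hz⟩

/-- A null vector of a four-dimensional Minkowski space is the first vector of a basis in which
the form has the shape `2 v₀ v₃ - v₁² - v₂²`. -/
theorem IsLorentzianForm.exists_null_coordinates {V : Type*} [AddCommGroup V] [Module ℝ V]
    [FiniteDimensional ℝ V] {ℓ : LinearMap.BilinForm ℝ V} (h : IsLorentzianForm ℓ)
    (hV : Module.finrank ℝ V = 4) {x : V} (hx0 : x ≠ 0) (hxx : ℓ x x = 0) :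
    ∃ φ : V ≃ₗ[ℝ] (Fin 4 → ℝ), φ x = ![1, 0, 0, 0] ∧
      ∀ v w, ParabolicExample.form (φ v) (φ w) = ℓ v w := by
  classical
  obtain ⟨e, he, -⟩ := h.exists_timelike
  have hex : ℓ e x ≠ 0 := fun h0 => hx0 (h.eq_zero_of_orthogonal he h0 hxx.ge)
  have hxe : ℓ x e = ℓ e x := h.symm _ _
  -- Scale `e` to have product 1 with `x`, then make it null by adding a multiple of `x`. The other
  -- two basis vectors come from the complement of `x`, `y`, which is negative definite because `x +
  -- y` is timelike.
  obtain ⟨y, hxy, hyy⟩ : ∃ y, ℓ x y = 1 ∧ ℓ y y = 0 := by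
    refine ⟨(ℓ e x)⁻¹ • e + (-((ℓ e x)⁻¹ ^ 2 * ℓ e e / 2)) • x, ?_, ?_⟩
    · simp only [map_add, map_smul, smul_eq_mul, hxx, hxe]
      field_simp
      ring
    · simp only [map_add, map_smul, LinearMap.add_apply, LinearMap.smul_apply, smul_eq_mul, hxx,
        hxe]
      field_simp
      ring
  have hyx : ℓ y x = 1 := by rw [h.symm, hxy]
  have hsum : 0 < ℓ (x + y) (x + y) := by
    simp only [map_add, LinearMap.add_apply, hxx, hxy, hyx, hyy]
    norm_num
  have normalize : ∀ u, u ≠ 0 → ℓ x u = 0 → ℓ y u = 0 →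
      ∃ r : ℝ, ℓ (r • u) (r • u) = -1 := by
    intro u hu hxu hyu
    have h1 := h.neg_of_orthogonal hsum (w := u) (by simp [hxu, hyu]) hu
    refine ⟨(Real.sqrt (-ℓ u u))⁻¹, ?_⟩
    have h2 : Real.sqrt (-ℓ u u) ^ 2 = -ℓ u u := Real.sq_sqrt (by linarith)
    have h3 : Real.sqrt (-ℓ u u) ≠ 0 := by
      rw [Real.sqrt_ne_zero']
      linarith
    simp only [map_smul, LinearMap.smul_apply, smul_eq_mul]
    field_simp
    linarith
  obtain ⟨z, hz⟩ := exists_notMem_span_of_card_lt ({x, y} : Finset V)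
    (lt_of_le_of_lt Finset.card_le_two (by omega))
  obtain ⟨a, hxa, hya, haa⟩ : ∃ a, ℓ x a = 0 ∧ ℓ y a = 0 ∧ ℓ a a = -1 := by
    set u := z - ℓ y z • x - ℓ x z • y with hu
    have hu0 : u ≠ 0 := by
      intro h0
      refine hz ?_
      have h1 : z = ℓ y z • x + ℓ x z • y := by
        rw [hu, sub_sub, sub_eq_zero] at h0
        exact h0
      rw [h1]
      exact add_mem (Submodule.smul_mem _ _ (Submodule.subset_span (by simp)))
        (Submodule.smul_mem _ _ (Submodule.subset_span (by simp)))
    have h1 : ℓ x u = 0 := by simp [hu, hxx, hxy]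
    have h2 : ℓ y u = 0 := by simp [hu, hyy, hyx]
    obtain ⟨r, hr⟩ := normalize u hu0 h1 h2
    exact ⟨r • u, by simp [h1], by simp [h2], hr⟩
  have hax : ℓ a x = 0 := by rw [h.symm, hxa]
  have hay : ℓ a y = 0 := by rw [h.symm, hya]
  obtain ⟨z', hz'⟩ := exists_notMem_span_of_card_lt ({x, y, a} : Finset V)
    (lt_of_le_of_lt Finset.card_le_three (by omega))
  obtain ⟨b, hxb, hyb, hab, hbb⟩ : ∃ b, ℓ x b = 0 ∧ ℓ y b = 0 ∧ ℓ a b = 0 ∧ ℓ b b = -1 := by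
    set u := z' - ℓ y z' • x - ℓ x z' • y + ℓ a z' • a with hu
    have hu0 : u ≠ 0 := by
      intro h0
      refine hz' ?_
      have h1 : z' = ℓ y z' • x + ℓ x z' • y - ℓ a z' • a := by
        rw [← sub_eq_zero, ← h0, hu]
        abel
      rw [h1]
      exact sub_mem (add_mem (Submodule.smul_mem _ _ (Submodule.subset_span (by simp)))
        (Submodule.smul_mem _ _ (Submodule.subset_span (by simp))))
        (Submodule.smul_mem _ _ (Submodule.subset_span (by simp)))
    have h1 : ℓ x u = 0 := by simp [hu, hxx, hxy, hxa]
    have h2 : ℓ y u = 0 := by simp [hu, hyy, hyx, hya]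
    have h3 : ℓ a u = 0 := by simp [hu, hax, hay, haa]
    obtain ⟨r, hr⟩ := normalize u hu0 h1 h2
    exact ⟨r • u, by simp [h1], by simp [h2], by simp [h3], hr⟩
  have hbx : ℓ b x = 0 := by rw [h.symm, hxb]
  have hby : ℓ b y = 0 := by rw [h.symm, hyb]
  have hba : ℓ b a = 0 := by rw [h.symm, hab]
  let ψ : (Fin 4 → ℝ) →ₗ[ℝ] V :=
    { toFun := fun c => c 0 • x + c 1 • a + c 2 • b + c 3 • y
      map_add' := fun c d => by
        simp only [Pi.add_apply, add_smul]
        abel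
      map_smul' := fun r c => by
        simp only [Pi.smul_apply, smul_eq_mul, mul_smul, smul_add, RingHom.id_apply] }
  have hψ : ∀ c, ψ c = c 0 • x + c 1 • a + c 2 • b + c 3 • y := fun c => rfl
  have hinj : Function.Injective ψ := by
    refine (injective_iff_map_eq_zero ψ).2 fun c hc => ?_
    have h0 : ℓ y (ψ c) = c 0 := by simp [hψ, hyx, hya, hyb, hyy]
    have h1 : ℓ a (ψ c) = -c 1 := by simp [hψ, hax, haa, hab, hay]
    have h2 : ℓ b (ψ c) = -c 2 := by simp [hψ, hbx, hba, hbb, hby]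
    have h3 : ℓ x (ψ c) = c 3 := by simp [hψ, hxx, hxa, hxb, hxy]
    rw [hc, map_zero] at h0 h1 h2 h3
    ext i
    fin_cases i
    · exact h0.symm
    · exact (neg_eq_zero.1 h1.symm)
    · exact (neg_eq_zero.1 h2.symm)
    · exact h3.symm
  let Φ : (Fin 4 → ℝ) ≃ₗ[ℝ] V := ψ.linearEquivOfInjective hinj (by simp [hV])
  have hΦ : ∀ c, Φ c = ψ c := fun c => rfl
  refine ⟨Φ.symm, ?_, fun v w => ?_⟩
  · rw [LinearEquiv.symm_apply_eq, hΦ, hψ]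
    simp
  · obtain ⟨c, rfl⟩ := Φ.surjective v
    obtain ⟨d, rfl⟩ := Φ.surjective w
    rw [Φ.symm_apply_apply, Φ.symm_apply_apply, hΦ, hΦ, hψ, hψ, ParabolicExample.form_apply]
    simp only [map_add, map_smul, LinearMap.add_apply, LinearMap.smul_apply, smul_eq_mul, hxx, hxa,
      hxb, hxy, hax, haa, hab, hay, hbx, hba, hbb, hby, hyx, hya, hyb, hyy]
    ring

/-! ### Affine isometries fixing a null vector. -/

/-- Coordinates of an affine isometry of `ℝ⁴` with the form `2 v₀ v₃ - v₁² - v₂²` whose linear part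
fixes the first basis vector: the orthogonal `2 × 2` matrix with the columns `(c, s)` and
`(-ε s, ε c)`, the vector `(b₁, b₂)`, and the translation `(t₀, t₁, t₂, t₃)`. -/
structure NullMotion where
  (c s ε b₁ b₂ t₀ t₁ t₂ t₃ : ℝ)
  sq_add_sq : c ^ 2 + s ^ 2 = 1
  sq_eq_one : ε ^ 2 = 1

namespace NullMotion

/-- The action on `ℝ⁴`. -/
noncomputable def act (p : NullMotion) (v : Fin 4 → ℝ) : Fin 4 → ℝ :=
  ![v 0 + (p.b₁ * p.c + p.b₂ * p.s) * v 1 + p.ε * (p.b₂ * p.c - p.b₁ * p.s) * v 2 +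
      (p.b₁ ^ 2 + p.b₂ ^ 2) / 2 * v 3 + p.t₀,
    p.c * v 1 - p.ε * p.s * v 2 + p.b₁ * v 3 + p.t₁,
    p.s * v 1 + p.ε * p.c * v 2 + p.b₂ * v 3 + p.t₂,
    v 3 + p.t₃]

variable (p q : NullMotion) (v : Fin 4 → ℝ)

theorem act_zero : p.act v 0 = v 0 + (p.b₁ * p.c + p.b₂ * p.s) * v 1 +
    p.ε * (p.b₂ * p.c - p.b₁ * p.s) * v 2 + (p.b₁ ^ 2 + p.b₂ ^ 2) / 2 * v 3 + p.t₀ := rfl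

theorem act_one : p.act v 1 = p.c * v 1 - p.ε * p.s * v 2 + p.b₁ * v 3 + p.t₁ := rfl

theorem act_two : p.act v 2 = p.s * v 1 + p.ε * p.c * v 2 + p.b₂ * v 3 + p.t₂ := rfl

theorem act_three : p.act v 3 = v 3 + p.t₃ := rfl

/-- The linear part is the identity on the plane. -/
def IsUnipotent (p : NullMotion) : Prop := p.c = 1 ∧ p.s = 0 ∧ p.ε = 1

/-- The motion `p` is the affine transformation `γ`. -/
def Represents (p : NullMotion) (γ : (Fin 4 → ℝ) ≃ᵃ[ℝ] (Fin 4 → ℝ)) : Prop :=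
  ∀ v, γ v = p.act v

variable {p q} {γ : (Fin 4 → ℝ) ≃ᵃ[ℝ] (Fin 4 → ℝ)}

theorem Represents.linear_apply (h : p.Represents γ) (v : Fin 4 → ℝ) :
    γ.linear v = p.act v - p.act 0 := by
  rw [← h, ← h, AffineEquiv.apply_eq_linear_add γ v, add_sub_cancel_right]

/-- The coordinates of a motion are determined by the action. -/
theorem eq_of_act_eq (h : ∀ v, p.act v = q.act v) : p.c = q.c ∧ p.s = q.s ∧ p.ε = q.ε ∧
    p.b₁ = q.b₁ ∧ p.b₂ = q.b₂ ∧ p.t₀ = q.t₀ ∧ p.t₁ = q.t₁ ∧ p.t₂ = q.t₂ ∧ p.t₃ = q.t₃ := by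
  have h0 : ∀ i, p.act 0 i = q.act 0 i := fun i => by rw [h]
  have h1 : ∀ i, p.act ![0, 1, 0, 0] i = q.act ![0, 1, 0, 0] i := fun i => by rw [h]
  have h2 : ∀ i, p.act ![0, 0, 1, 0] i = q.act ![0, 0, 1, 0] i := fun i => by rw [h]
  have h3 : ∀ i, p.act ![0, 0, 0, 1] i = q.act ![0, 0, 0, 1] i := fun i => by rw [h]
  have h00 := h0 0
  have h01 := h0 1
  have h02 := h0 2
  have h03 := h0 3
  have h11 := h1 1
  have h12 := h1 2
  have h21 := h2 1
  have h22 := h2 2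
  have h31 := h3 1
  have h32 := h3 2
  simp [act_zero, act_one, act_two, act_three] at h00 h01 h02 h03 h11 h12 h21 h22 h31 h32
  have hc : p.c = q.c := by linarith
  have hs : p.s = q.s := by linarith
  refine ⟨hc, hs, ?_, by linarith, by linarith, h00, h01, h02, h03⟩
  -- The sign is seen only through `ε c` and `ε s`; it is recovered from `c ^ 2 + s ^ 2 = 1`.
  have h4 : p.ε * q.c = q.ε * q.c := by rw [← hc] ; rw [← hc] at h22; linarith
  have h5 : p.ε * q.s = q.ε * q.s := by rw [← hs] ; rw [← hs] at h21; linarith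
  linear_combination q.c * h4 + q.s * h5 - (p.ε - q.ε) * q.sq_add_sq

/-- The data `(c, s, ε, b₁, b₂)` compose as Euclidean motions of the plane, and `t₃` is additive.
The other translation coordinates are left implicit in the action. -/
theorem act_mul_eq (p q : NullMotion) : ∃ r : NullMotion, (∀ v, r.act v = p.act (q.act v)) ∧
    r.c = p.c * q.c - p.ε * p.s * q.s ∧ r.s = p.s * q.c + p.ε * p.c * q.s ∧ r.ε = p.ε * q.ε ∧
    r.b₁ = p.c * q.b₁ - p.ε * p.s * q.b₂ + p.b₁ ∧ r.b₂ = p.s * q.b₁ + p.ε * p.c * q.b₂ + p.b₂ ∧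
    r.t₃ = p.t₃ + q.t₃ := by
  have h1 := p.sq_add_sq
  have h2 := p.sq_eq_one
  have h3 := q.sq_add_sq
  have h4 := q.sq_eq_one
  refine ⟨⟨p.c * q.c - p.ε * p.s * q.s, p.s * q.c + p.ε * p.c * q.s, p.ε * q.ε,
    p.c * q.b₁ - p.ε * p.s * q.b₂ + p.b₁, p.s * q.b₁ + p.ε * p.c * q.b₂ + p.b₂,
    p.act (q.act 0) 0, p.act (q.act 0) 1, p.act (q.act 0) 2, p.t₃ + q.t₃, ?_, ?_⟩, fun v => ?_,
    rfl, rfl, rfl, rfl, rfl, rfl⟩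
  · linear_combination (q.c ^ 2 + q.s ^ 2 * p.ε ^ 2) * h1 + q.s ^ 2 * h2 + h3
  · linear_combination q.ε ^ 2 * h2 + h4
  · ext i
    fin_cases i
    · simp [act_zero, act_one, act_two, act_three]
      linear_combination
        (q.b₁ * (q.c * v 1 - q.ε * q.s * v 2 + q.b₁ * v 3 / 2) +
          p.ε ^ 2 * q.b₂ * (q.s * v 1 + q.ε * q.c * v 2 + q.b₂ * v 3 / 2)) * h1 +
        (q.b₂ * (q.s * v 1 + q.ε * q.c * v 2 + q.b₂ * v 3 / 2) - (p.c * p.b₁ + p.s * p.b₂ +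
          (p.c ^ 2 + p.s ^ 2) * q.b₁) * q.s * q.ε * v 2) * h2
    · simp [act_zero, act_one, act_two, act_three]
      linear_combination -(p.c * q.s * q.ε * v 2) * h2
    · simp [act_zero, act_one, act_two, act_three]
      linear_combination -(p.s * q.s * q.ε * v 2) * h2
    · simp [act_zero, act_one, act_two, act_three]
      ring

/-- An affine isometry whose linear part fixes the first basis vector has such coordinates. -/
theorem exists_represents (hform : ∀ v w, ParabolicExample.form (γ.linear v) (γ.linear w) =
    ParabolicExample.form v w) (hnull : γ.linear ![1, 0, 0, 0] = ![1, 0, 0, 0]) :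
    ∃ p : NullMotion, p.Represents γ := by
  set x := γ.linear ![0, 1, 0, 0] with hx
  set y := γ.linear ![0, 0, 1, 0] with hy
  set z := γ.linear ![0, 0, 0, 1] with hz
  have hx0 := hform ![1, 0, 0, 0] ![0, 1, 0, 0]
  have hy0 := hform ![1, 0, 0, 0] ![0, 0, 1, 0]
  have hz0 := hform ![1, 0, 0, 0] ![0, 0, 0, 1]
  have hxx := hform ![0, 1, 0, 0] ![0, 1, 0, 0]
  have hxy := hform ![0, 1, 0, 0] ![0, 0, 1, 0]
  have hxz := hform ![0, 1, 0, 0] ![0, 0, 0, 1]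
  have hyy := hform ![0, 0, 1, 0] ![0, 0, 1, 0]
  have hyz := hform ![0, 0, 1, 0] ![0, 0, 0, 1]
  have hzz := hform ![0, 0, 0, 1] ![0, 0, 0, 1]
  rw [← hx] at hx0 hxx hxy hxz
  rw [← hy] at hy0 hxy hyy hyz
  rw [← hz] at hz0 hxz hyz hzz
  rw [hnull] at hx0 hy0 hz0
  simp [ParabolicExample.form_apply] at hx0 hy0 hz0 hxx hxy hxz hyy hyz hzz
  simp only [hx0, hy0, hz0] at hxx hxy hxz hyy hyz hzz
  have hlin : ∀ v, γ.linear v = v 0 • ![1, 0, 0, 0] + v 1 • x + v 2 • y + v 3 • z := by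
    intro v
    have hv : v = v 0 • ![1, 0, 0, 0] + v 1 • ![0, 1, 0, 0] + v 2 • ![0, 0, 1, 0] +
        v 3 • ![0, 0, 0, 1] := by
      ext i
      fin_cases i <;> simp
    conv_lhs => rw [hv]
    rw [map_add, map_add, map_add, map_smul, map_smul, map_smul, map_smul, hnull]
  have hxx' : x 1 ^ 2 + x 2 ^ 2 = 1 := by linarith
  have hyy' : y 1 ^ 2 + y 2 ^ 2 = 1 := by linarith
  have hxy' : x 1 * y 1 + x 2 * y 2 = 0 := by linarith
  -- The second column of an orthogonal matrix is the first turned by a right angle, times the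
  -- determinant; the determinant is `ε`.
  have hy1 : y 1 = -((x 1 * y 2 - x 2 * y 1) * x 2) := by
    linear_combination (-y 1) * hxx' + x 1 * hxy'
  have hy2 : y 2 = (x 1 * y 2 - x 2 * y 1) * x 1 := by
    linear_combination (-y 2) * hxx' + x 2 * hxy'
  refine ⟨⟨x 1, x 2, x 1 * y 2 - x 2 * y 1, z 1, z 2, γ 0 0, γ 0 1, γ 0 2, γ 0 3, hxx', ?_⟩, ?_⟩
  · linear_combination (y 1 ^ 2 + y 2 ^ 2) * hxx' + hyy' - (x 1 * y 1 + x 2 * y 2) * hxy'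
  · intro v
    have key : ∀ i, γ v i = v 0 * ![1, 0, 0, 0] i + v 1 * x i + v 2 * y i + v 3 * z i + γ 0 i := by
      intro i
      rw [AffineEquiv.apply_eq_linear_add, hlin]
      rfl
    ext i
    fin_cases i
    · refine (key 0).trans ?_
      simp [act_zero]
      linear_combination v 1 * hxz + v 2 * hyz + v 3 * hzz / 2 + v 2 * z 1 * hy1 + v 2 * z 2 * hy2
    · refine (key 1).trans ?_
      simp [act_one]
      linear_combination v 2 * hy1
    · refine (key 2).trans ?_
      simp [act_two]
      linear_combination v 2 * hy2
    · refine (key 3).trans ?_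
      simp [act_three, hx0, hy0, hz0]

end NullMotion

/-! ### The induced plane motions and the existence of a unipotent element. -/

namespace NullMotion

/-- The identity. -/
def id : NullMotion := ⟨1, 0, 1, 0, 0, 0, 0, 0, 0, by norm_num, by norm_num⟩

theorem act_id (v : Fin 4 → ℝ) : id.act v = v := by
  ext i
  fin_cases i <;> simp [act, id]

/-- The motion `p` induces a motion of the plane that fixes the point `(x, y)`. -/
def Fixes (p : NullMotion) (x y : ℝ) : Prop :=
  p.c * x - p.ε * p.s * y + p.b₁ = x ∧ p.s * x + p.ε * p.c * y + p.b₂ = y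

end NullMotion

namespace IsStrictlyParabolic

open NullMotion

variable {Γ : Subgroup ((Fin 4 → ℝ) ≃ᵃ[ℝ] (Fin 4 → ℝ))} {γ δ : (Fin 4 → ℝ) ≃ᵃ[ℝ] (Fin 4 → ℝ)}
  {p q r : NullMotion}

theorem exists_rep (h : IsStrictlyParabolic ParabolicExample.form ![1, 0, 0, 0] Γ) (hγ : γ ∈ Γ) :
    ∃ p : NullMotion, p.Represents γ :=
  exists_represents (h.map_form γ hγ) (h.map_null γ hγ)

/-- The inequality says that the displacement of `v` is not spacelike. -/
theorem eq_id (h : IsStrictlyParabolic ParabolicExample.form ![1, 0, 0, 0] Γ) (hγ : γ ∈ Γ)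
    (hp : p.Represents γ) (v : Fin 4 → ℝ)
    (hv : (p.act v 1 - v 1) ^ 2 + (p.act v 2 - v 2) ^ 2 ≤ 2 * (p.act v 0 - v 0) * p.t₃) :
    γ = 1 ∧ p.c = 1 ∧ p.s = 0 ∧ p.ε = 1 ∧ p.b₁ = 0 ∧ p.b₂ = 0 ∧ p.t₀ = 0 ∧ p.t₁ = 0 ∧ p.t₂ = 0 ∧
      p.t₃ = 0 := by
  have h1 : γ = 1 := by
    refine h.eq_one γ hγ v ?_
    rw [hp, ParabolicExample.form_apply]
    have h3 : (p.act v - v) 3 = p.t₃ := by simp [act_three]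
    rw [h3]
    simp only [Pi.sub_apply]
    linarith
  refine ⟨h1, eq_of_act_eq (q := NullMotion.id) fun w => ?_⟩
  rw [act_id, ← hp, h1]
  rfl

/-- If the translation along a fixed direction of the plane part is not trivial, the last
coordinate is kept. -/
theorem t₃_eq_zero (h : IsStrictlyParabolic ParabolicExample.form ![1, 0, 0, 0] Γ) (hγ : γ ∈ Γ)
    (hp : p.Represents γ) {x y : ℝ} (hx : p.c * x - p.ε * p.s * y = x)
    (hy : p.s * x + p.ε * p.c * y = y) (hb : p.b₁ * x + p.b₂ * y ≠ 0) : p.t₃ = 0 := by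
  by_contra ht
  -- Moving along the fixed direction `(x, y)` changes only coordinate 0 of the displacement. This
  -- `a` makes the displacement null.
  set a := ((p.t₁ ^ 2 + p.t₂ ^ 2) / (2 * p.t₃) - p.t₀) / (p.b₁ * x + p.b₂ * y) with ha
  have ha' : 2 * (a * (p.b₁ * x + p.b₂ * y) + p.t₀) * p.t₃ = p.t₁ ^ 2 + p.t₂ ^ 2 := by
    rw [ha]
    field_simp
    ring
  refine ht (h.eq_id hγ hp ![0, a * x, a * y, 0] ?_).2.2.2.2.2.2.2.2.2
  simp [act_zero, act_one, act_two]
  refine le_of_eq ?_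
  have e1 : p.c * (a * x) - p.ε * p.s * (a * y) + p.t₁ - a * x = p.t₁ := by
    linear_combination a * hx
  have e2 : p.s * (a * x) + p.ε * p.c * (a * y) + p.t₂ - a * y = p.t₂ := by
    linear_combination a * hy
  have e0 : (p.b₁ * p.c + p.b₂ * p.s) * (a * x) + p.ε * (p.b₂ * p.c - p.b₁ * p.s) * (a * y) +
      p.t₀ = a * (p.b₁ * x + p.b₂ * y) + p.t₀ := by
    linear_combination a * p.b₁ * hx + a * p.b₂ * hy
  rw [e0, e1, e2, ha']

/-- Motions that keep the last coordinate have no fixed points on the planes where it is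
constant. -/
theorem eq_id_of_fixed (h : IsStrictlyParabolic ParabolicExample.form ![1, 0, 0, 0] Γ) (hγ : γ ∈ Γ)
    (hp : p.Represents γ) (ht : p.t₃ = 0) {x y z : ℝ}
    (hx : p.c * x - p.ε * p.s * y + p.b₁ * z + p.t₁ = x)
    (hy : p.s * x + p.ε * p.c * y + p.b₂ * z + p.t₂ = y) :
    γ = 1 ∧ p.c = 1 ∧ p.s = 0 ∧ p.ε = 1 ∧ p.b₁ = 0 ∧ p.b₂ = 0 ∧ p.t₀ = 0 ∧ p.t₁ = 0 ∧ p.t₂ = 0 ∧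
      p.t₃ = 0 := by
  refine h.eq_id hγ hp ![0, x, y, z] ?_
  simp [act_one, act_two, hx, hy, ht]

/-- The plane motion is a reflection without glide. A component of `b` along the axis would give `t₃
= 0`, and then on a suitable level `v₃ = z` the glide `b z + t` along the axis would vanish, leaving
a fixed point there. The vectors `(1 + c, s)` and `(s, 1 - c)` both lie on the axis; each serves for
one of the equations. -/
theorem reflection_eq (h : IsStrictlyParabolic ParabolicExample.form ![1, 0, 0, 0] Γ) (hγ : γ ∈ Γ)
    (hp : p.Represents γ) (hε : p.ε = -1) :
    p.c * p.b₁ + p.s * p.b₂ = -p.b₁ ∧ p.s * p.b₁ - p.c * p.b₂ = -p.b₂ := by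
  have h1 := p.sq_add_sq
  constructor
  · by_contra hne
    have hb : p.b₁ * (1 + p.c) + p.b₂ * p.s ≠ 0 := fun h0 => hne (by linarith)
    have ht := h.t₃_eq_zero hγ hp (x := 1 + p.c) (y := p.s)
      (by rw [hε]; linear_combination h1) (by rw [hε]; ring) hb
    set z := -(p.t₁ * (1 + p.c) + p.t₂ * p.s) / (p.b₁ * (1 + p.c) + p.b₂ * p.s) with hz
    have hz' : (p.b₁ * z + p.t₁) * (1 + p.c) + (p.b₂ * z + p.t₂) * p.s = 0 := by
      have : z * (p.b₁ * (1 + p.c) + p.b₂ * p.s) = -(p.t₁ * (1 + p.c) + p.t₂ * p.s) := by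
        rw [hz]
        exact div_mul_cancel₀ _ hb
      linear_combination this
    have hc : 1 + p.c ≠ 0 := by
      intro hc
      have hc' : p.c = -1 := by linarith
      have : p.s = 0 := by
        rw [hc'] at h1
        nlinarith
      exact hb (by rw [hc, this]; ring)
    have hz2 : p.s * (p.b₁ * z + p.t₁) + (1 - p.c) * (p.b₂ * z + p.t₂) = 0 := by
      apply mul_left_cancel₀ hc
      linear_combination p.s * hz' - (p.b₂ * z + p.t₂) * h1
    have := (h.eq_id_of_fixed hγ hp ht (x := (p.b₁ * z + p.t₁) / 2) (y := (p.b₂ * z + p.t₂) / 2)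
      (z := z) (by rw [hε]; linear_combination hz' / 2)
      (by rw [hε]; linear_combination hz2 / 2)).2.2.2.1
    linarith
  · by_contra hne
    have hb : p.b₁ * p.s + p.b₂ * (1 - p.c) ≠ 0 := fun h0 => hne (by linarith)
    have ht := h.t₃_eq_zero hγ hp (x := p.s) (y := 1 - p.c)
      (by rw [hε]; ring) (by rw [hε]; linear_combination h1) hb
    set z := -(p.t₁ * p.s + p.t₂ * (1 - p.c)) / (p.b₁ * p.s + p.b₂ * (1 - p.c)) with hz
    have hz' : (p.b₁ * z + p.t₁) * p.s + (p.b₂ * z + p.t₂) * (1 - p.c) = 0 := by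
      have : z * (p.b₁ * p.s + p.b₂ * (1 - p.c)) = -(p.t₁ * p.s + p.t₂ * (1 - p.c)) := by
        rw [hz]
        exact div_mul_cancel₀ _ hb
      linear_combination this
    have hc : 1 - p.c ≠ 0 := by
      intro hc
      have hc' : p.c = 1 := by linarith
      have : p.s = 0 := by
        rw [hc'] at h1
        nlinarith
      exact hb (by rw [hc, this]; ring)
    have hz2 : (1 + p.c) * (p.b₁ * z + p.t₁) + p.s * (p.b₂ * z + p.t₂) = 0 := by
      apply mul_left_cancel₀ hc
      linear_combination p.s * hz' - (p.b₁ * z + p.t₁) * h1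
    have := (h.eq_id_of_fixed hγ hp ht (x := (p.b₁ * z + p.t₁) / 2) (y := (p.b₂ * z + p.t₂) / 2)
      (z := z) (by rw [hε]; linear_combination hz2 / 2)
      (by rw [hε]; linear_combination hz' / 2)).2.2.2.1
    linarith

/-- The element `γ⁻¹ δ` is unipotent, so `hU` applies to it: the orthogonal part determines the
plane motion. -/
theorem b_eq_of_linear_eq (h : IsStrictlyParabolic ParabolicExample.form ![1, 0, 0, 0] Γ)
    (hU : ∀ γ ∈ Γ, ∀ p : NullMotion, p.Represents γ → p.IsUnipotent → p.b₁ = 0 ∧ p.b₂ = 0)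
    (hγ : γ ∈ Γ) (hδ : δ ∈ Γ) (hp : p.Represents γ) (hq : q.Represents δ) (hc : p.c = q.c)
    (hs : p.s = q.s) (hε : p.ε = q.ε) : p.b₁ = q.b₁ ∧ p.b₂ = q.b₂ := by
  obtain ⟨r, hr⟩ := h.exists_rep (Γ.mul_mem (Γ.inv_mem hγ) hδ)
  obtain ⟨m, hm, mc, ms, mε, mb₁, mb₂, -⟩ := act_mul_eq p r
  have hmq : ∀ v, m.act v = q.act v := by
    intro v
    rw [hm, ← hq, ← hr, ← hp]
    exact γ.apply_symm_apply (δ v)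
  obtain ⟨ec, es, eε, eb₁, eb₂, -⟩ := eq_of_act_eq hmq
  rw [mc, ← hc] at ec
  rw [ms, ← hs] at es
  rw [mε, ← hε] at eε
  have h1 := p.sq_add_sq
  have h2 := p.sq_eq_one
  have rc : r.c = 1 := by linear_combination p.c * ec + p.s * es + (1 - r.c) * h1
  have rε : r.ε = 1 := by linear_combination p.ε * eε + (1 - r.ε) * h2
  have rs : r.s = 0 := by
    rw [rc] at ec es
    linear_combination p.ε * p.c * es - p.ε * p.s * ec - p.ε ^ 2 * r.s * h1 - r.s * h2
  obtain ⟨rb₁, rb₂⟩ := hU _ (Γ.mul_mem (Γ.inv_mem hγ) hδ) r hr ⟨rc, rs, rε⟩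
  rw [mb₁, rb₁, rb₂] at eb₁
  rw [mb₂, rb₁, rb₂] at eb₂
  exact ⟨by linarith, by linarith⟩

/-- If all unipotent elements keep the plane part trivial, the plane motions have a common fixed
point. -/
theorem exists_common_fixed (h : IsStrictlyParabolic ParabolicExample.form ![1, 0, 0, 0] Γ)
    (hU : ∀ γ ∈ Γ, ∀ p : NullMotion, p.Represents γ → p.IsUnipotent → p.b₁ = 0 ∧ p.b₂ = 0) :
    ∃ x y : ℝ, ∀ γ ∈ Γ, ∀ p : NullMotion, p.Represents γ → p.Fixes x y := by
  have hsgn : ∀ p : NullMotion, p.ε = 1 ∨ p.ε = -1 := fun p =>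
    mul_self_eq_one_iff.1 (by rw [← sq, p.sq_eq_one])
  by_cases hrot : ∃ γ ∈ Γ, ∃ p : NullMotion, p.Represents γ ∧ p.ε = 1 ∧ p.c ≠ 1
  · obtain ⟨γ, hγ, p, hp, hε, hc⟩ := hrot
    have h1 := p.sq_add_sq
    have hD : 2 - 2 * p.c ≠ 0 := fun h0 => hc (by linarith)
    -- A nontrivial rotation has one fixed point, `(1 - A)⁻¹ b`, with `det (1 - A) = 2 - 2c`.
    have hfix : ∃ x y, ∀ u v : ℝ, p.Fixes u v ↔ u = x ∧ v = y := by
      refine ⟨((1 - p.c) * p.b₁ - p.s * p.b₂) / (2 - 2 * p.c),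
        (p.s * p.b₁ + (1 - p.c) * p.b₂) / (2 - 2 * p.c), fun u v => ?_⟩
      rw [eq_div_iff hD, eq_div_iff hD, Fixes, hε]
      constructor
      · rintro ⟨e1, e2⟩
        constructor
        · linear_combination (p.c - 1) * e1 + p.s * e2 - u * h1
        · linear_combination -p.s * e1 + (p.c - 1) * e2 - v * h1
      · rintro ⟨e1, e2⟩
        constructor <;> apply mul_left_cancel₀ hD
        · linear_combination (p.c - 1) * e1 - p.s * e2 - p.b₁ * h1
        · linear_combination p.s * e1 + (p.c - 1) * e2 - p.b₂ * h1
    obtain ⟨x, y, hxy⟩ := hfix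
    obtain ⟨f1, f2⟩ := (hxy x y).2 ⟨rfl, rfl⟩
    refine ⟨x, y, fun δ hδ q hq => ?_⟩
    -- By uniqueness it suffices that `q` sends the fixed point of `p` to a fixed point of `p`. If
    -- `q` is orientation preserving, `p q` and `q p` have the same orthogonal part; if it is
    -- reversing, `p q p` and `q` do. In either case the plane motions agree.
    suffices p.Fixes (q.c * x - q.ε * q.s * y + q.b₁) (q.s * x + q.ε * q.c * y + q.b₂) from
      (hxy _ _).1 this
    obtain ⟨m, hm, mc, ms, mε, mb₁, mb₂, -⟩ := act_mul_eq p q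
    have hm' : m.Represents (γ * δ) := fun v => by rw [hm, ← hq, ← hp]; rfl
    rw [hε] at f1 f2 mc ms mε mb₁ mb₂
    rcases hsgn q with hq1 | hq1
    · obtain ⟨n, hn, nc, ns, nε, nb₁, nb₂, -⟩ := act_mul_eq q p
      have hn' : n.Represents (δ * γ) := fun v => by rw [hn, ← hp, ← hq]; rfl
      obtain ⟨e1, e2⟩ := h.b_eq_of_linear_eq hU (Γ.mul_mem hγ hδ) (Γ.mul_mem hδ hγ) hm' hn'
        (by rw [mc, nc, hq1]; ring) (by rw [ms, ns, hq1]; ring) (by rw [mε, nε, hε]; ring)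
      rw [mb₁, nb₁, hq1] at e1
      rw [mb₂, nb₂, hq1] at e2
      rw [Fixes, hε, hq1]
      constructor
      · linear_combination e1 + q.c * f1 - q.s * f2
      · linear_combination e2 + q.s * f1 + q.c * f2
    · obtain ⟨n, hn, nc, ns, nε, nb₁, nb₂, -⟩ := act_mul_eq m p
      have hn' : n.Represents (γ * δ * γ) := fun v => by rw [hn, ← hp, ← hm']; rfl
      rw [hq1] at mε
      obtain ⟨e1, e2⟩ := h.b_eq_of_linear_eq hU (Γ.mul_mem (Γ.mul_mem hγ hδ) hγ) hδ hn' hq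
        (by rw [nc, mc, mε, ms]; linear_combination q.c * h1)
        (by rw [ns, mc, mε, ms]; linear_combination q.s * h1)
        (by rw [nε, mε, hε, hq1]; ring)
      rw [nb₁, mb₁, mc, mε, ms] at e1
      rw [nb₂, mb₂, mc, mε, ms] at e2
      rw [Fixes, hε, hq1]
      constructor
      · linear_combination e1 - (p.c * q.c - 1 * p.s * q.s) * f1 - (p.s * q.c + 1 * p.c * q.s) * f2 +
          (q.c * x + q.s * y) * h1
      · linear_combination e2 - (p.s * q.c + 1 * p.c * q.s) * f1 + (p.c * q.c - 1 * p.s * q.s) * f2 +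
          (q.s * x - q.c * y) * h1
  · push Not at hrot
    have hunip : ∀ γ ∈ Γ, ∀ p : NullMotion, p.Represents γ → p.ε = 1 → p.IsUnipotent := by
      intro γ hγ p hp hε
      have hc := hrot γ hγ p hp hε
      have h1 := p.sq_add_sq
      refine ⟨hc, ?_, hε⟩
      rw [hc] at h1
      nlinarith
    have htriv : ∀ γ ∈ Γ, ∀ p : NullMotion, p.Represents γ → p.ε = 1 → ∀ x y, p.Fixes x y := by
      intro γ hγ p hp hε x y
      have hu := hunip γ hγ p hp hε
      obtain ⟨hb₁, hb₂⟩ := hU γ hγ p hp hu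
      obtain ⟨hc, hs, -⟩ := hu
      rw [Fixes, hc, hs, hε, hb₁, hb₂]
      constructor <;> ring
    by_cases href : ∃ γ ∈ Γ, ∃ p : NullMotion, p.Represents γ ∧ p.ε = -1
    · obtain ⟨γ, hγ, p, hp, hε⟩ := href
      have h1 := p.sq_add_sq
      obtain ⟨r1, r2⟩ := h.reflection_eq hγ hp hε
      -- Since `A b = -b`, the point `b / 2` is fixed. A product of two reflections is unipotent
      -- here, so all reflections induce the same plane motion.
      refine ⟨p.b₁ / 2, p.b₂ / 2, fun δ hδ q hq => ?_⟩
      rcases hsgn q with hq1 | hq1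
      · exact htriv δ hδ q hq hq1 _ _
      · obtain ⟨m, hm, mc, ms, mε, -⟩ := act_mul_eq p q
        have hm' : m.Represents (γ * δ) := fun v => by rw [hm, ← hq, ← hp]; rfl
        obtain ⟨ec, es, -⟩ := hunip _ (Γ.mul_mem hγ hδ) m hm' (by rw [mε, hε, hq1]; ring)
        rw [mc, hε] at ec
        rw [ms, hε] at es
        have hqc : p.c = q.c := by linear_combination -p.c * ec - p.s * es + q.c * h1
        have hqs : p.s = q.s := by linear_combination -p.s * ec + p.c * es + q.s * h1
        obtain ⟨e1, e2⟩ := h.b_eq_of_linear_eq hU hγ hδ hp hq hqc hqs (by rw [hε, hq1])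
        rw [Fixes, ← e1, ← e2, ← hqc, ← hqs, hq1]
        constructor
        · linear_combination r1 / 2
        · linear_combination r2 / 2
    · push Not at href
      exact ⟨0, 0, fun γ hγ p hp => htriv γ hγ p hp
        ((hsgn p).resolve_right (href γ hγ p hp)) _ _⟩

/-- There is a unipotent element with nontrivial plane part. -/
theorem exists_unipotent (h : IsStrictlyParabolic ParabolicExample.form ![1, 0, 0, 0] Γ) :
    ∃ γ ∈ Γ, ∃ p : NullMotion, p.Represents γ ∧ p.IsUnipotent ∧ (p.b₁ ≠ 0 ∨ p.b₂ ≠ 0) := by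
  by_contra! hcon
  obtain ⟨x, y, hxy⟩ := h.exists_common_fixed hcon
  -- On vectors with last coordinate 1 the linear parts act on the middle coordinates by the plane
  -- motion. The first entry is chosen so that the square is 2; invariance of the form then keeps
  -- that entry as well.
  obtain ⟨γ, hγ, hne⟩ := h.not_fixed ![(x ^ 2 + y ^ 2) / 2 + 1, x, y, 1] (by
    simp [ParabolicExample.form_apply]
    linarith)
  obtain ⟨p, hp⟩ := h.exists_rep hγ
  obtain ⟨e1, e2⟩ := hxy γ hγ p hp
  refine hne ?_
  rw [hp.linear_apply]
  have h1 := p.sq_add_sq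
  have h2 := p.sq_eq_one
  ext i
  fin_cases i
  · simp [act_zero]
    have e3 : (p.b₁ ^ 2 + p.b₂ ^ 2) / 2 = p.b₁ * x + p.b₂ * y := by
      have e4 : (x - p.b₁) ^ 2 + (y - p.b₂) ^ 2 = x ^ 2 + y ^ 2 := by
        rw [show x - p.b₁ = p.c * x - p.ε * p.s * y by linarith,
          show y - p.b₂ = p.s * x + p.ε * p.c * y by linarith]
        linear_combination (x ^ 2 + p.ε ^ 2 * y ^ 2) * h1 + y ^ 2 * h2
      linarith
    linear_combination p.b₁ * e1 + p.b₂ * e2 - e3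
  · simp [act_one]
    linarith
  · simp [act_two]
    linarith
  · simp [act_three]

end IsStrictlyParabolic

/-! ### Normal form of a unipotent element and cyclicity of the group. -/

namespace NullMotion

/-- The linear part of the change of coordinates that brings a unipotent motion to normal form. -/
noncomputable def normalizeLinear (b₁ b₂ D : ℝ) (hB : b₁ ^ 2 + b₂ ^ 2 ≠ 0) (hD : D ≠ 0) :
    (Fin 4 → ℝ) ≃ₗ[ℝ] (Fin 4 → ℝ) where
  toFun v := ![v 0 / D, (b₂ * v 1 - b₁ * v 2) / D, (b₁ * v 1 + b₂ * v 2) / D,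
    (b₁ ^ 2 + b₂ ^ 2) * v 3 / D]
  map_add' v w := by
    ext i
    fin_cases i <;> simp <;> ring
  map_smul' r v := by
    ext i
    fin_cases i <;> simp <;> ring
  invFun y := ![D * y 0, D * (b₂ * y 1 + b₁ * y 2) / (b₁ ^ 2 + b₂ ^ 2),
    D * (b₂ * y 2 - b₁ * y 1) / (b₁ ^ 2 + b₂ ^ 2), D * y 3 / (b₁ ^ 2 + b₂ ^ 2)]
  left_inv v := by
    ext i
    fin_cases i <;> simp <;> field_simp <;> ring
  right_inv v := by
    ext i
    fin_cases i <;> simp <;> field_simp <;> ring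

theorem normalizeLinear_apply {b₁ b₂ D : ℝ} (hB : b₁ ^ 2 + b₂ ^ 2 ≠ 0) (hD : D ≠ 0)
    (v : Fin 4 → ℝ) : normalizeLinear b₁ b₂ D hB hD v = ![v 0 / D, (b₂ * v 1 - b₁ * v 2) / D,
      (b₁ * v 1 + b₂ * v 2) / D, (b₁ ^ 2 + b₂ ^ 2) * v 3 / D] := rfl

/-- Coordinates of `gamma n`. -/
def ofInt (n : ℤ) : NullMotion := ⟨1, 0, 1, 0, n, 0, n, 0, 0, by norm_num, by norm_num⟩

theorem represents_ofInt (n : ℤ) : (ofInt n).Represents (ParabolicExample.gamma n) := by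
  intro v
  rw [ParabolicExample.gamma_apply, ParabolicExample.linMatrix_mulVec]
  ext i
  fin_cases i <;> simp [ofInt, act, ParabolicExample.transVec]

end NullMotion

namespace IsStrictlyParabolic

open NullMotion ParabolicExample

variable {Γ : Subgroup ((Fin 4 → ℝ) ≃ᵃ[ℝ] (Fin 4 → ℝ))} {γ δ : (Fin 4 → ℝ) ≃ᵃ[ℝ] (Fin 4 → ℝ)}
  {p q r : NullMotion}

/-- A unipotent element with nontrivial plane part is conjugate to `gamma 1`. -/
theorem exists_conj_eq_gamma_one (h : IsStrictlyParabolic form ![1, 0, 0, 0] Γ) (hγ : γ ∈ Γ)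
    (hp : p.Represents γ) (hu : p.IsUnipotent) (hb : p.b₁ ≠ 0 ∨ p.b₂ ≠ 0) :
    ∃ (g : (Fin 4 → ℝ) ≃ᵃ[ℝ] (Fin 4 → ℝ)) (t k : ℝ), 0 < t ∧ k ≠ 0 ∧
      (∀ v w, form (g.linear v) (g.linear w) = t * form v w) ∧
      g.linear ![1, 0, 0, 0] = k • ![1, 0, 0, 0] ∧ g.conjHom γ = gamma 1 := by
  obtain ⟨hc, hs, hε⟩ := hu
  have hB : 0 < p.b₁ ^ 2 + p.b₂ ^ 2 := by
    rcases hb with hb | hb <;> positivity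
  have ht : p.t₃ = 0 := h.t₃_eq_zero hγ hp (x := p.b₁) (y := p.b₂) (by simp [hc, hs])
    (by simp [hc, hs, hε]) (by nlinarith)
  -- If `(t₁, t₂)` were parallel to `b`, then `b z + t = 0` for some `z`, and points of the level
  -- `v₃ = z` would be moved by a null vector.
  have hD : p.b₂ * p.t₁ - p.b₁ * p.t₂ ≠ 0 := by
    intro hD
    set z := -(p.b₁ * p.t₁ + p.b₂ * p.t₂) / (p.b₁ ^ 2 + p.b₂ ^ 2) with hz
    have hz' : z * (p.b₁ ^ 2 + p.b₂ ^ 2) = -(p.b₁ * p.t₁ + p.b₂ * p.t₂) := div_mul_cancel₀ _ hB.ne'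
    have h1 := h.eq_id_of_fixed hγ hp ht (x := 0) (y := 0) (z := z)
      (by
        apply mul_left_cancel₀ hB.ne'
        linear_combination p.b₁ * hz' + p.b₂ * hD)
      (by
        apply mul_left_cancel₀ hB.ne'
        linear_combination p.b₂ * hz' - p.b₁ * hD)
    rcases hb with hb | hb
    · exact hb h1.2.2.2.2.1
    · exact hb h1.2.2.2.2.2.1
  set D := p.b₂ * p.t₁ - p.b₁ * p.t₂ with hD_def
  set a := p.b₁ * p.t₁ + p.b₂ * p.t₂ with ha
  let L := normalizeLinear p.b₁ p.b₂ D hB.ne' hD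
  let g : (Fin 4 → ℝ) ≃ᵃ[ℝ] (Fin 4 → ℝ) :=
    -- The last entry absorbs the component of `(t₁, t₂)` along `b`; given it, the third one absorbs
    -- `t₀`.
    L.toAffineEquiv.trans (AffineEquiv.constVAdd ℝ _ ![0, 0, (p.t₀ - a / 2) / D, a / D])
  have hgl : ∀ v, g.linear v = L v := fun v => rfl
  have hg : ∀ v, g v = ![0, 0, (p.t₀ - a / 2) / D, a / D] + L v := fun v => rfl
  refine ⟨g, (p.b₁ ^ 2 + p.b₂ ^ 2) / D ^ 2, 1 / D, by positivity, by positivity,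
    fun v w => ?_, ?_, ?_⟩
  · rw [hgl, hgl, normalizeLinear_apply, normalizeLinear_apply, form_apply, form_apply]
    simp
    field_simp
    ring
  · rw [hgl, normalizeLinear_apply]
    ext i
    fin_cases i <;> simp
  · ext1 w
    obtain ⟨v, rfl⟩ := g.surjective w
    rw [AffineEquiv.conjHom_apply, represents_ofInt 1, hp, hg, hg, normalizeLinear_apply,
      normalizeLinear_apply]
    ext i
    fin_cases i
    · simp [act, hc, hs, hε, ofInt]
      field_simp
      ring
    · simp [act, hc, hs, hε, ofInt]
      field_simp
      rw [hD_def]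
      ring
    · simp [act, hc, hs, hε, ofInt]
      field_simp
      rw [ha]
      ring
    · simp [act, ht, ofInt]

theorem pow_apply (hp : p.Represents γ) (hu : p.IsUnipotent) (ht : p.t₃ = 0) (n : ℕ)
    (v : Fin 4 → ℝ) : (γ ^ n) v 1 = v 1 + n * (p.b₁ * v 3 + p.t₁) ∧
      (γ ^ n) v 2 = v 2 + n * (p.b₂ * v 3 + p.t₂) ∧ (γ ^ n) v 3 = v 3 := by
  obtain ⟨hc, hs, hε⟩ := hu
  induction n with
  | zero => simp
  | succ n ih =>
    obtain ⟨e1, e2, e3⟩ := ih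
    have h1 : (γ ^ (n + 1)) v = p.act ((γ ^ n) v) := by
      rw [← hp, pow_succ']
      rfl
    rw [h1, act_one, act_two, act_three, e1, e2, e3, hc, hs, hε, ht]
    push_cast
    refine ⟨by ring, by ring, by ring⟩

/-- The orbits are isolated in the last three coordinates. -/
theorem exists_isolated (h : IsStrictlyParabolic form ![1, 0, 0, 0] Γ) (v : Fin 4 → ℝ) :
    ∃ ε : ℝ, 0 < ε ∧ ∀ γ ∈ Γ, |γ v 1 - v 1| < ε → |γ v 2 - v 2| < ε → |γ v 3 - v 3| < ε →
      γ = 1 := by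
  obtain ⟨N, hN, hiso⟩ := h.isolated v
  obtain ⟨ε, hε, hball⟩ := Metric.mem_nhds_iff.1 hN
  refine ⟨ε, hε, fun γ hγ h1 h2 h3 => hiso γ hγ (v 0 - γ v 0) (hball ?_)⟩
  rw [Metric.mem_ball, dist_pi_lt_iff hε]
  intro i
  fin_cases i
  · simpa [Real.dist_eq] using hε
  · simpa [Real.dist_eq] using h1
  · simpa [Real.dist_eq] using h2
  · simpa [Real.dist_eq] using h3

/-- The element `gamma 1` restricts the unipotent elements: they commute with it, and are
commensurable with it. -/
theorem unipotent_eq (h : IsStrictlyParabolic form ![1, 0, 0, 0] Γ) (hg : gamma 1 ∈ Γ)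
    (hγ : γ ∈ Γ) (hp : p.Represents γ) (hu : p.IsUnipotent) (ht : p.t₃ = 0) :
    p.b₁ = 0 ∧ p.t₂ = 0 ∧ p.t₁ = p.b₂ := by
  obtain ⟨hc, hs, hε⟩ := hu
  have hgp := represents_ofInt 1
  -- The images of 0 under `gamma 1 * γ` and `γ * gamma 1` differ only in coordinate 0, a null
  -- difference. So the two elements commute, and that coordinate gives the equality.
  have ht₂ : p.t₂ = p.b₁ := by
    set w := γ (gamma 1 0) with hw
    have h1 : (gamma 1 * γ) * (γ * gamma 1)⁻¹ = 1 := by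
      refine h.eq_one _ (Γ.mul_mem (Γ.mul_mem hg hγ) (Γ.inv_mem (Γ.mul_mem hγ hg))) w ?_
      have h2 : ((gamma 1 * γ) * (γ * gamma 1)⁻¹) w = gamma 1 (γ 0) := by
        change gamma 1 (γ ((γ * gamma 1).symm ((γ * gamma 1) 0))) = _
        rw [AffineEquiv.symm_apply_apply]
      rw [h2, hw, hp, hgp, hp, hgp, form_apply]
      simp [act, ofInt, hc, hs, hε, ht]
      refine le_of_eq ?_
      ring
    have h3 : gamma 1 (γ 0) = γ (gamma 1 0) := by
      have h4 := mul_inv_eq_one.1 h1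
      exact congrArg (fun f : (Fin 4 → ℝ) ≃ᵃ[ℝ] (Fin 4 → ℝ) => f 0) h4
    have h5 := congrFun h3 0
    rw [hp, hgp, hp, hgp] at h5
    simp [act, ofInt, hc, hs, hε, ht] at h5
    linarith
  -- On the level `v₃ = z`, `γ` and `gamma 1` translate the plane by `(b₁ z + t₁, b₂ z + t₂)` and
  -- `(1, z)`. These are parallel when `z` solves this quadratic, whose discriminant is `(t₁ - b₂) ^
  -- 2 + 4 b₁ ^ 2`.
  obtain ⟨z, hz⟩ : ∃ z, p.b₁ * (z * z) + (p.t₁ - p.b₂) * z + -p.b₁ = 0 := by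
    by_cases hb : p.b₁ = 0
    · exact ⟨0, by simp [hb]⟩
    · have h1 : 0 ≤ discrim p.b₁ (p.t₁ - p.b₂) (-p.b₁) := by
        rw [discrim]
        nlinarith [sq_nonneg (p.t₁ - p.b₂), sq_nonneg p.b₁]
      exact exists_quadratic_eq_zero hb ⟨_, (Real.mul_self_sqrt h1).symm⟩
  set ρ := p.b₁ * z + p.t₁ with hρ
  have hρ₂ : p.b₂ * z + p.t₂ = ρ * z := by
    rw [ht₂, hρ]
    linear_combination -hz
  obtain ⟨ε, hε0, hiso⟩ := h.exists_isolated ![0, 0, 0, z]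
  obtain ⟨n, hn⟩ := exists_nat_one_div_lt (show 0 < ε / (1 + |z|) by positivity)
  -- Dirichlet approximation of the ratio `ρ` of the two translations: `gamma (-j) * γ ^ k` moves
  -- the chosen point by less than `ε` modulo `x`, so it is trivial.
  obtain ⟨k, hk0, -, hk⟩ := Real.exists_nat_abs_mul_sub_round_le ρ (Nat.succ_pos n)
  set j := round ((k : ℝ) * ρ) with hj
  have hsmall : |(k : ℝ) * ρ - j| * (1 + |z|) < ε := by
    rw [← lt_div_iff₀ (by positivity)]
    refine (hk.trans ?_).trans_lt hn
    exact one_div_le_one_div_of_le (by positivity) (by push_cast; linarith)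
  have habs := abs_nonneg ((k : ℝ) * ρ - j)
  have hpow : ∀ v, gamma j v 1 = (γ ^ k) v 1 ∧ gamma j v 2 = (γ ^ k) v 2 := by
    have h1 : gamma (-j) * γ ^ k = 1 := by
      have hgj : ∀ i : ℤ, gamma i ∈ Γ := by
        intro i
        have h2 : ∀ n : ℕ, gamma n ∈ Γ := by
          intro n
          induction n with
          | zero => simp [gamma_zero]
          | succ n ih =>
            push_cast
            rw [← gamma_mul]
            exact Γ.mul_mem ih hg
        obtain ⟨n, rfl | rfl⟩ := i.eq_nat_or_neg
        · exact h2 n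
        · have h3 : gamma (-n) = (gamma n)⁻¹ := by
            rw [eq_inv_iff_mul_eq_one, gamma_mul, neg_add_cancel, gamma_zero]
          rw [h3]
          exact Γ.inv_mem (h2 n)
      obtain ⟨e1, e2, e3⟩ := pow_apply hp ⟨hc, hs, hε⟩ ht k ![0, 0, 0, z]
      have e0 : (gamma (-j) * γ ^ k) ![0, 0, 0, z] =
        (ofInt (-j)).act ((γ ^ k) ![0, 0, 0, z]) := represents_ofInt _ _
      simp at e1 e2 e3
      rw [← hρ] at e1
      rw [hρ₂] at e2
      refine hiso _ (Γ.mul_mem (hgj _) (Γ.pow_mem hγ k)) ?_ ?_ ?_ <;> rw [e0]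
      · rw [act_one, e1, e2, e3]
        simp [ofInt]
        rw [← sub_eq_add_neg]
        nlinarith [abs_nonneg z]
      · rw [act_two, e1, e2, e3]
        simp [ofInt]
        rw [show (k : ℝ) * (ρ * z) + -(j * z) = (k * ρ - j) * z by ring, abs_mul]
        nlinarith [abs_nonneg z]
      · rw [act_three, e3]
        simpa [ofInt] using hε0
    have h2 : γ ^ k = gamma j := by
      have h3 : gamma j * (gamma (-j) * γ ^ k) = gamma j := by rw [h1, mul_one]
      rwa [← mul_assoc, gamma_mul, add_neg_cancel, gamma_zero, one_mul] at h3
    intro v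
    rw [h2]
    exact ⟨rfl, rfl⟩
  have hk' : (k : ℝ) ≠ 0 := by positivity
  have key : ∀ x : ℝ, k * (p.b₁ * x + p.t₁) = j ∧ k * (p.b₂ * x + p.t₂) = j * x := by
    intro x
    obtain ⟨h1, h2⟩ := hpow ![0, 0, 0, x]
    obtain ⟨e1, e2, -⟩ := pow_apply hp ⟨hc, hs, hε⟩ ht k ![0, 0, 0, x]
    rw [e1, represents_ofInt] at h1
    rw [e2, represents_ofInt] at h2
    simp [act, ofInt] at h1 h2
    exact ⟨h1.symm, h2.symm⟩
  obtain ⟨h01, h02⟩ := key 0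
  obtain ⟨h11, h12⟩ := key 1
  refine ⟨?_, ?_, ?_⟩ <;> apply mul_left_cancel₀ hk' <;> linarith

/-- If `gamma 1` belongs to the group, all elements are unipotent. -/
theorem unipotent_of_gamma_one_mem (h : IsStrictlyParabolic form ![1, 0, 0, 0] Γ)
    (hg : gamma 1 ∈ Γ) (hγ : γ ∈ Γ) (hp : p.Represents γ) : p.IsUnipotent ∧ p.t₃ = 0 := by
  have hδ : γ * gamma 1 * γ⁻¹ ∈ Γ := Γ.mul_mem (Γ.mul_mem hγ hg) (Γ.inv_mem hγ)
  obtain ⟨q, hq⟩ := h.exists_rep hδ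
  have hqp : ∀ v, q.act (p.act v) = p.act ((ofInt 1).act v) := by
    intro v
    rw [← hq, ← hp, ← represents_ofInt 1, ← hp]
    change γ (gamma 1 (γ.symm (γ v))) = _
    rw [γ.symm_apply_apply]
  have h1 := p.sq_add_sq
  have h2 := p.sq_eq_one
  obtain ⟨m, hm, mc, ms, mε, -, -, mt⟩ := act_mul_eq q p
  obtain ⟨n, hn, nc, ns, nε, -, -, nt⟩ := act_mul_eq p (ofInt 1)
  obtain ⟨ec, es, eε, -, -, -, -, -, et⟩ := eq_of_act_eq (p := m) (q := n)
    (fun v => by rw [hm, hn, hqp])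
  rw [mc, nc] at ec
  rw [ms, ns] at es
  rw [mε, nε] at eε
  rw [mt, nt] at et
  simp only [ofInt] at ec es eε et
  have qε : q.ε = 1 := by linear_combination p.ε * eε + (1 - q.ε) * h2
  rw [qε] at ec es
  have qc : q.c = 1 := by linear_combination p.c * ec + p.s * es + (1 - q.c) * h1
  have qs : q.s = 0 := by linear_combination p.c * es - p.s * ec - q.s * h1
  have qt : q.t₃ = 0 := by linarith
  -- The conjugate of `gamma 1` by `γ` is unipotent, so it has the shape given by `unipotent_eq`.
  -- Comparing it with `gamma 1` at 0 and at the last basis vector leaves only `c = 1` or `c = -1`.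
  obtain ⟨qb₁, qt₂, qt₁⟩ := h.unipotent_eq hg hδ hq ⟨qc, qs, qε⟩ qt
  have e0 := hqp 0
  have e3 := hqp ![0, 0, 0, 1]
  have e01 := congrFun e0 1
  have e02 := congrFun e0 2
  have e31 := congrFun e3 1
  have e32 := congrFun e3 2
  simp [act, ofInt, qc, qs, qε, qb₁, qt₁, qt₂] at e01 e02 e31 e32
  have hεs : p.ε * p.s = 0 := by linarith
  have hs : p.s = 0 := by linear_combination p.ε * hεs - p.s * h2
  have hcc : p.c ^ 2 = 1 := by
    rw [hs] at h1
    linarith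
  have hqc : q.b₂ = p.c := by linarith
  have ht : p.t₃ = 0 := by
    have h3 : p.c * p.t₃ = 0 := by
      rw [← hqc]
      linarith
    linear_combination p.c * h3 - p.t₃ * hcc
  have hε : p.ε = 1 := by
    have h3 : p.ε * p.c = p.c := by
      rw [ht, hqc] at e32
      rw [ht, hs] at e02
      linarith
    linear_combination p.c * h3 + (1 - p.ε) * hcc
  refine ⟨⟨?_, hs, hε⟩, ht⟩
  -- For `c = -1` the motion is a half-turn on the level `v₃ = 0`, with the fixed point `(t₁ / 2, t₂
  -- / 2)`.
  by_contra hc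
  have hc' : p.c = -1 := (mul_self_eq_one_iff.1 (by rw [← sq, hcc])).resolve_left hc
  exact hc (h.eq_id_of_fixed hγ hp ht (x := p.t₁ / 2) (y := p.t₂ / 2) (z := 0)
    (by rw [hc', hs]; ring) (by rw [hc', hs, hε]; ring)).2.1

/-- If `gamma 1` belongs to the group, it is cyclic. -/
theorem exists_generator (h : IsStrictlyParabolic form ![1, 0, 0, 0] Γ) (hg : gamma 1 ∈ Γ) :
    ∃ γ ∈ Γ, Γ = Subgroup.zpowers γ ∧
      ∃ p : NullMotion, p.Represents γ ∧ p.IsUnipotent ∧ (p.b₁ ≠ 0 ∨ p.b₂ ≠ 0) := by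
  have hall : ∀ γ ∈ Γ, ∀ v, γ v 1 = v 1 + γ 0 1 ∧ γ v 2 = v 2 + γ 0 1 * v 3 ∧ γ v 3 = v 3 := by
    intro γ hγ v
    obtain ⟨p, hp⟩ := h.exists_rep hγ
    obtain ⟨hu, ht⟩ := h.unipotent_of_gamma_one_mem hg hγ hp
    obtain ⟨b1, t2, t1⟩ := h.unipotent_eq hg hγ hp hu ht
    obtain ⟨hc, hs, hε⟩ := hu
    simp only [hp _, act_one, act_two, act_three, hc, hs, hε, b1, t2, t1, ht, Pi.zero_apply]
    refine ⟨by ring, by ring, by ring⟩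
  -- The translation in coordinate 1 embeds `Γ` in `ℝ`: where it vanishes, 0 is moved by a multiple
  -- of `x`. Isolation of the orbit of 0 makes the image discrete, hence cyclic.
  let F : Γ →* Multiplicative ℝ := MonoidHom.mk' (fun γ => Multiplicative.ofAdd (γ.1 0 1)) (by
    intro γ δ
    rw [← ofAdd_add]
    congr 1
    change γ.1 (δ.1 0) 1 = _
    rw [(hall γ.1 γ.2 _).1, add_comm])
  have hF : ∀ γ : Γ, γ.1 0 1 = Multiplicative.toAdd (F γ) := fun γ => rfl
  have hinj : ∀ γ : Γ, F γ = 1 → γ = 1 := by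
    intro γ hγ
    have h0 : γ.1 0 1 = 0 := hγ
    obtain ⟨-, e2, e3⟩ := hall γ.1 γ.2 0
    refine Subtype.ext (h.eq_one γ.1 γ.2 0 ?_)
    rw [form_apply]
    simp [e2, e3, h0]
  obtain ⟨ε, hε, hiso⟩ := h.exists_isolated 0
  obtain ⟨b, hb⟩ := AddSubgroup.cyclic_of_isolated_zero (H := (MonoidHom.toAdditiveLeft F).range)
    hε (by
      rw [Set.disjoint_left]
      rintro _ ⟨γ, rfl⟩ ⟨h1, h2⟩
      have h3 : (MonoidHom.toAdditiveLeft F) γ = γ.toMul.1 0 1 := rfl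
      rw [h3] at h1 h2
      obtain ⟨-, e2, e3⟩ := hall γ.toMul.1 γ.toMul.2 0
      have h4 := hiso γ.toMul.1 γ.toMul.2 (by simpa [abs_of_pos h1] using h2) (by simpa [e2] using hε)
        (by simpa [e3] using hε)
      rw [h4] at h1
      simp at h1)
  have hbmem : b ∈ (MonoidHom.toAdditiveLeft F).range := by
    rw [hb]
    exact AddSubgroup.mem_closure_singleton_self b
  obtain ⟨γ, hγ⟩ := hbmem
  have hgen : ∀ δ : Γ, ∃ n : ℤ, δ = γ.toMul ^ n := by
    intro δ
    have h1 : (MonoidHom.toAdditiveLeft F) (Additive.ofMul δ) ∈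
      (MonoidHom.toAdditiveLeft F).range := ⟨_, rfl⟩
    rw [hb, AddSubgroup.mem_closure_singleton] at h1
    obtain ⟨n, hn⟩ := h1
    refine ⟨n, ?_⟩
    rw [← mul_inv_eq_one]
    refine hinj _ ?_
    rw [map_mul, map_inv, map_zpow, mul_inv_eq_one]
    rw [← hγ, ← map_zsmul] at hn
    rw [← map_zpow]
    exact hn.symm
  refine ⟨γ.toMul.1, γ.toMul.2, ?_, ?_⟩
  · refine le_antisymm (fun δ hδ => ?_) (by simp)
    obtain ⟨n, hn⟩ := hgen ⟨δ, hδ⟩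
    exact ⟨n, (congrArg Subtype.val hn).symm⟩
  · obtain ⟨p, hp⟩ := h.exists_rep γ.toMul.2
    obtain ⟨hu, ht⟩ := h.unipotent_of_gamma_one_mem hg γ.toMul.2 hp
    obtain ⟨b1, t2, t1⟩ := h.unipotent_eq hg γ.toMul.2 hp hu ht
    refine ⟨p, hp, hu, Or.inr fun hb₂ => ?_⟩
    have h0 : γ.toMul.1 0 1 = 0 := by
      rw [hp]
      simp [act, t1, hb₂]
    have h1 : γ.toMul = 1 := hinj _ h0
    obtain ⟨n, hn⟩ := hgen ⟨gamma 1, hg⟩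
    rw [h1, one_zpow] at hn
    have h2 : gamma 1 0 1 = 0 := by rw [show gamma 1 = 1 from congrArg Subtype.val hn]; rfl
    rw [gamma_apply_one] at h2
    simp at h2

theorem zpowers_gamma_one : Subgroup.zpowers (gamma 1) = ParabolicExample.group := by
  have h : ∀ n : ℤ, gamma 1 ^ n = gamma n := by
    let f : Multiplicative ℤ →* ((Fin 4 → ℝ) ≃ᵃ[ℝ] (Fin 4 → ℝ)) :=
      MonoidHom.mk' (fun n => gamma n.toAdd) fun m n => (gamma_mul _ _).symm
    intro n
    have h1 := map_zpow f (Multiplicative.ofAdd 1) n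
    rw [← ofAdd_zsmul] at h1
    simpa [f] using h1.symm
  ext δ
  constructor
  · rintro ⟨n, rfl⟩
    exact ⟨n, (h n).symm⟩
  · rintro ⟨n, rfl⟩
    exact ⟨n, h n⟩

/-- The group is conjugate, by a homothety, to the model group. -/
theorem exists_conj_eq_group (h : IsStrictlyParabolic form ![1, 0, 0, 0] Γ) :
    ∃ (g : (Fin 4 → ℝ) ≃ᵃ[ℝ] (Fin 4 → ℝ)) (t : ℝ), 0 < t ∧
      (∀ v w, form (g.linear v) (g.linear w) = t * form v w) ∧
      Γ.map g.conjHom = ParabolicExample.group := by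
  obtain ⟨γ, hγ, p, hp, hu, hb⟩ := h.exists_unipotent
  obtain ⟨g, t, k, ht, hk, hform, hnull, hconj⟩ := h.exists_conj_eq_gamma_one hγ hp hu hb
  have h' := h.conj g ht hk hform hnull
  obtain ⟨δ, hδ, hgen, q, hq, hqu, hqb⟩ := h'.exists_generator ⟨γ, hγ, hconj⟩
  -- Now `gamma 1` may be a proper power of the generator, so the normalization is repeated for the
  -- generator itself.
  obtain ⟨g', t', k', ht', hk', hform', hnull', hconj'⟩ :=
    h'.exists_conj_eq_gamma_one hδ hq hqu hqb
  refine ⟨g.trans g', t' * t, by positivity, fun v w => ?_, ?_⟩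
  · change form (g'.linear (g.linear v)) (g'.linear (g.linear w)) = _
    rw [hform', hform, mul_assoc]
  · have h1 : (g.trans g').conjHom = g'.conjHom.comp g.conjHom := rfl
    rw [h1, ← Subgroup.map_map, hgen, MonoidHom.map_zpowers, hconj', zpowers_gamma_one]

end IsStrictlyParabolic

/-! ### Passage to the quotient manifolds. -/

namespace AffineEquiv

variable {V W : Type*} [NormedAddCommGroup V] [NormedSpace ℝ V] [FiniteDimensional ℝ V]
  [NormedAddCommGroup W] [NormedSpace ℝ W]

theorem hasFDerivAt_of_finiteDimensional (g : V ≃ᵃ[ℝ] W) (v : V) :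
    HasFDerivAt g (LinearMap.toContinuousLinearMap (g.linear : V →ₗ[ℝ] W)) v := by
  have h : (g : V → W) = fun v => LinearMap.toContinuousLinearMap (g.linear : V →ₗ[ℝ] W) v + g 0 :=
    funext g.apply_eq_linear_add
  rw [h]
  exact (ContinuousLinearMap.hasFDerivAt _).add_const _

theorem contDiff_of_finiteDimensional (g : V ≃ᵃ[ℝ] W) : ContDiff ℝ ∞ g := by
  have h : (g : V → W) = fun v => LinearMap.toContinuousLinearMap (g.linear : V →ₗ[ℝ] W) v + g 0 :=
    funext g.apply_eq_linear_add
  rw [h]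
  exact (ContinuousLinearMap.contDiff _).add contDiff_const

end AffineEquiv

namespace FlatLorentzianManifold

variable {V W : Type*} [NormedAddCommGroup V] [NormedSpace ℝ V] [FiniteDimensional ℝ V]
  [NormedAddCommGroup W] [NormedSpace ℝ W] [FiniteDimensional ℝ W]
  {M₁ : FlatLorentzianManifold V} {M₂ : FlatLorentzianManifold W}

/-- An affine isomorphism that conjugates the groups and multiplies the form by a positive factor
induces a homothety. -/
theorem homothetic_of_conj (g : V ≃ᵃ[ℝ] W) {t : ℝ} (ht : 0 < t)
    (hform : ∀ v w, M₂.form (g.linear v) (g.linear w) = t * M₁.form v w)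
    (hgroup : M₁.group.map g.conjHom = M₂.group) : M₁.Homothetic M₂ := by
  have hrel : ∀ v w, M₁.orbitSetoid.r v w ↔ M₂.orbitSetoid.r (g v) (g w) := by
    intro v w
    constructor
    · rintro ⟨γ, hγ, rfl⟩
      exact ⟨g.conjHom γ, by rw [← hgroup]; exact ⟨γ, hγ, rfl⟩, g.conjHom_apply γ v⟩
    · rintro ⟨δ, hδ, h⟩
      rw [← hgroup] at hδ
      obtain ⟨γ, hγ, rfl⟩ := hδ
      rw [AffineEquiv.conjHom_apply] at h
      exact ⟨γ, hγ, g.injective h⟩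
  have hrel' : ∀ v w, M₂.orbitSetoid.r v w → M₁.orbitSetoid.r (g.symm v) (g.symm w) := by
    intro v w h
    rw [hrel, g.apply_symm_apply, g.apply_symm_apply]
    exact h
  have hg := g.contDiff_of_finiteDimensional
  have hg' := g.symm.contDiff_of_finiteDimensional
  let f : M₁.Carrier ≃ₜ M₂.Carrier :=
    { toFun := Quotient.map g fun v w h => (hrel v w).1 h
      invFun := Quotient.map g.symm fun v w h => hrel' v w h
      left_inv := by
        rintro ⟨v⟩
        exact congrArg M₁.proj (g.symm_apply_apply v)
      right_inv := by
        rintro ⟨v⟩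
        exact congrArg M₂.proj (g.apply_symm_apply v)
      continuous_toFun := hg.continuous.quotient_map' _
      continuous_invFun := hg'.continuous.quotient_map' _ }
  have hlift : IsSmoothLift M₁ M₂ f univ g :=
    ⟨isOpen_univ, hg.contDiffOn, fun u _ => rfl⟩
  refine ⟨t, ht, f, fun v => ⟨univ, g, mem_univ v, hlift⟩, fun v => ⟨univ, g.symm, mem_univ v,
    isOpen_univ, hg'.contDiffOn, fun u _ => rfl⟩, fun v => ⟨univ, g, mem_univ v, hlift,
    fun u _ x y => ?_⟩⟩
  rw [(g.hasFDerivAt_of_finiteDimensional u).fderiv]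
  exact hform x y

end FlatLorentzianManifold

theorem mainTheorem4 {V : Type*} [NormedAddCommGroup V] [NormedSpace ℝ V] [FiniteDimensional ℝ V]
    (hV : Module.finrank ℝ V = 4) (M : FlatLorentzianManifold V)
    (hM : M.IsStrictlyCausal) (hne : ¬ M.IsElliptic) :
    FlatLorentzianManifold.Homothetic M parabolicManifold := by
  obtain ⟨x, hx0, hxx, hpar⟩ := hM.exists_isStrictlyParabolic hne
  obtain ⟨φ, hφx, hφ⟩ := M.lorentzian.exists_null_coordinates hV hx0 hxx
  have hpar' : IsStrictlyParabolic ParabolicExample.form ![1, 0, 0, 0]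
      (M.group.map φ.toAffineEquiv.conjHom) :=
    hpar.conj φ.toAffineEquiv one_pos one_ne_zero (fun v w => by rw [one_mul]; exact hφ v w)
      (by rw [one_smul]; exact hφx)
  obtain ⟨g, t, ht, hform, hgroup⟩ := hpar'.exists_conj_eq_group
  refine FlatLorentzianManifold.homothetic_of_conj (φ.toAffineEquiv.trans g) ht (fun v w => ?_) ?_
  · exact (hform (φ v) (φ w)).trans (by rw [hφ])
  · rw [Subgroup.map_map] at hgroup
    exact hgroup
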